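/- Let $\nu$ be a rotationally invariant Borel probability measure on $\mathbb C$ with $\int_{\mathbb C}\bigl|\log|z|\bigr|\,d\nu(z)<\infty$ (in particular $\nu(\{0\})=0$), and let $V^\nu(z)=\int_{\mathbb C}\log|z-w|\,d\nu(w)$. For $0\le k\le n$ put $$\|z^k\|_{n,\nu}=\Bigl(\int_{\mathbb C}|z|^{2k}e^{-2nV^\nu(z)}\,d\nu(z)\Bigr)^{1/2}.$$ Let $(a_k)_{k\ge 0}$ be i.i.d. complex random variables such that $a_0\ne 0$ almost surely, $a_0$ is not deterministic (not almost surely equal to a constant), and $\mathbb E\log(1+|a_0|)<\infty$. Let $$P_n(z)=\sum_{k=0}^n a_k\,\frac{z^k}{\|z^k\|_{n,\nu}} .$$ For an open set $U\subset\mathbb C$, let $\mathcal C_U$ be the space of locally finite point configurations in $U$ (points counted with multiplicity) with the vague topology, i.e. the smallest topology for which $P\mapsto\sum_{x\in P}f(x)$ is continuous for every continuous compactly supported $f:U\to\mathbb R$. A point process on $U$ is a random element of $\mathcal C_U$ (for the Borel $\sigma$-algebra), and convergence in law of point processes on $U$ is weak convergence of their laws on $\mathcal C_U$. Zeros are always counted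 with multiplicity. Let $R>0$, $D_R=\{|z|<R\}$, $\bar D_R=\{|z|\le R\}$, $\mathbb D=D_1$. 1. (Disk case.) If $D_R$ is a connected component of $\mathbb C\setminus\operatorname{supp}\nu$, then almost surely $\sum_{k\ge0}a_kz^k$ converges for every $z\in\mathbb D$, and, as $n\to\infty$, the point process of the zeros of $P_n$ in $D_R$ converges in law, as point processes on $D_R$, to $$R\cdot\Bigl\{z\in\mathbb D:\ \sum_{k=0}^\infty a_kz^k=0\Bigr\}.$$ 2. (Complement of a disk case.) If $\mathbb C\setminus\bar D_R$ is a connected component of $\mathbb C\setminus\operatorname{supp}\nu$, then almost surely $\sum_{k\ge0}a_kz^{-k}$ converges for every $|z|>1$, and, as $n\to\infty$, the point process of the zeros of $P_n$ in $\mathbb C\setminus\bar D_R$ converges in law, as point processes on $\mathbb C\setminus\bar D_R$, to $$R\cdot\Bigl\{z\in\mathbb C\setminus\bar{\mathbb D}:\ \sum_{k=0}^\infty a_kz^{-k}=0\Bigr\}.$$ -/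

import Mathlib

open MeasureTheory ProbabilityTheory Filter Topology
open scoped CompactlySupported

/-! ### Point configurations and point processes -/

/-- A point configuration on `X`: a locally finite family of points of `X`, counted with
multiplicity (equivalently, a locally finite measure taking values in `ℕ ∪ {∞}`). -/
@[ext]
structure PointConfig (X : Type*) [TopologicalSpace X] where
  /-- the multiplicity of each point (zero if the point does not belong to the configuration) -/
  mult : X → ℕ
  locallyFinite : LocallyFiniteSupport mult

namespace PointConfig

variable {X Y : Type*} [TopologicalSpace X] [TopologicalSpace Y]

/-- The sum of the values of `f` over the points of a configuration, with multiplicity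
(a finite sum when `f` has compact support). -/
noncomputable def linStat (f : X → ℝ) (P : PointConfig X) : ℝ :=
  ∑ᶠ x : X, (P.mult x : ℝ) * f x

/-- The vague topology: the smallest topology such that `P ↦ ∑_{x ∈ P} f x` is continuous for
every continuous `f : X → ℝ` with compact support. -/
noncomputable instance : TopologicalSpace (PointConfig X) :=
  ⨅ f : C_c(X, ℝ), TopologicalSpace.induced (linStat f) inferInstance

noncomputable instance : MeasurableSpace (PointConfig X) := borel _

instance : BorelSpace (PointConfig X) := ⟨rfl⟩

/-- The image of a point configuration under a homeomorphism. -/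
def map (e : X ≃ₜ Y) (P : PointConfig X) : PointConfig Y where
  mult y := P.mult (e.symm y)
  locallyFinite y := by
    obtain ⟨t, ht, hfin⟩ := P.locallyFinite (e.symm y)
    refine ⟨e.symm ⁻¹' t, e.symm.continuous.continuousAt ht, ?_⟩
    have h : e.symm ⁻¹' t ∩ Function.support (fun y => P.mult (e.symm y))
        = e.symm ⁻¹' (t ∩ Function.support P.mult) := rfl
    rw [h]
    exact hfin.preimage e.symm.injective.injOn

end PointConfig

lemma locallyFiniteSupport_analyticOrder {U : Set ℂ} {f : ℂ → ℂ} (hf : AnalyticOnNhd ℂ f U) :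
    LocallyFiniteSupport (fun x : U => analyticOrderNatAt f x) := by
  intro x
  suffices h : ∃ s ∈ 𝓝 (x : ℂ), ∀ y ∈ s, analyticOrderNatAt f y ≠ 0 → y = (x : ℂ) by
    obtain ⟨s, hs, h⟩ := h
    refine ⟨Subtype.val ⁻¹' s, continuous_subtype_val.continuousAt hs,
      (Set.finite_singleton x).subset ?_⟩
    rintro y ⟨hy, hy'⟩
    exact Subtype.ext (h y hy hy')
  rcases (hf x x.2).eventually_eq_zero_or_eventually_ne_zero with h | h
  · refine ⟨_, eventually_eventually_nhds.2 h, fun y hy hne => (hne ?_).elim⟩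
    rw [analyticOrderNatAt, analyticOrderAt_eq_top.2 hy]
    rfl
  · rw [eventually_nhdsWithin_iff] at h
    refine ⟨_, h, fun y hy hne => ?_⟩
    by_contra hxy
    exact hy hxy (apply_eq_zero_of_analyticOrderNatAt_ne_zero hne)

open Classical in
/-- The zeros in `U` of a function `f` that is holomorphic on `U` and not identically zero near
any point of `U`, each counted with its multiplicity, as a point configuration on `U`.
(If `f` is not holomorphic on `U`, the value is the empty configuration.) -/
noncomputable def zerosIn (U : Set ℂ) (f : ℂ → ℂ) : PointConfig U :=
  if hf : AnalyticOnNhd ℂ f U then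
    { mult := fun x => analyticOrderNatAt f x
      locallyFinite := locallyFiniteSupport_analyticOrder hf }
  else
    { mult := fun _ => 0
      locallyFinite := fun _ => ⟨Set.univ, univ_mem, by simp⟩ }

/-! ### Disks, their complements, and dilations -/

/-- The open disk of radius `R` centred at `0`. -/
def disk (R : ℝ) : Set ℂ := {z | ‖z‖ < R}

/-- The complement of the closed disk of radius `R` centred at `0`. -/
def exteriorDisk (R : ℝ) : Set ℂ := {z | R < ‖z‖}

/-- The dilation `z ↦ R z` as a homeomorphism from the unit disk to the disk of radius `R`. -/
noncomputable def diskDilation {R : ℝ} (hR : 0 < R) : disk 1 ≃ₜ disk R :=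
  (Homeomorph.mulLeft₀ (R : ℂ) (Complex.ofReal_ne_zero.2 hR.ne')).subtype fun z => by
    simp [disk, abs_of_pos hR, hR]

/-- The dilation `z ↦ R z` as a homeomorphism from the complement of the closed unit disk to the
complement of the closed disk of radius `R`. -/
noncomputable def exteriorDilation {R : ℝ} (hR : 0 < R) : exteriorDisk 1 ≃ₜ exteriorDisk R :=
  (Homeomorph.mulLeft₀ (R : ℂ) (Complex.ofReal_ne_zero.2 hR.ne')).subtype fun z => by
    simp [exteriorDisk, abs_of_pos hR, hR]

/-- `U` is a connected component of the set `S`. -/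
def IsComponentOf (U S : Set ℂ) : Prop := ∃ x ∈ S, connectedComponentIn S x = U

/-! ### The background measure -/

/-- `ν` is invariant under rotations about the origin and `∫ |log |z|| dν(z) < ∞`. As
`Real.log 0 = 0`, the fact that `0` is not an atom (where `log |z| = -∞`) is a separate field. -/
structure IsBackground (ν : Measure ℂ) : Prop where
  rotationInvariant : ∀ c : ℂ, ‖c‖ = 1 → ν.map (fun z => c * z) = ν
  zero_not_atom : ν {0} = 0
  integrable_log : Integrable (fun z : ℂ => Real.log ‖z‖) ν

/-- The logarithmic potential `V^ν(z) = ∫ log |z - w| dν(w)`. -/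
noncomputable def logPotential (ν : Measure ℂ) (z : ℂ) : ℝ :=
  ∫ w, Real.log ‖z - w‖ ∂ν

/-- The norm of the monomial `z ^ k` for the inner product
`⟨P, Q⟩_{n,ν} = ∫ P(z) conj(Q(z)) exp(-2 n V^ν(z)) dν(z)`. -/
noncomputable def monomialNorm (ν : Measure ℂ) (n k : ℕ) : ℝ :=
  Real.sqrt (∫ z, ‖z ^ k‖ ^ 2 * Real.exp (-2 * n * logPotential ν z) ∂ν)

/-! ### Random coefficients, polynomials and series -/

/-- `(a_k)` are i.i.d. complex random variables, almost surely nonzero, not almost surely equal to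
a constant, and such that `E log (1 + |a_0|) < ∞`. -/
structure IsCoefficientSequence {Ω : Type*} [MeasurableSpace Ω] (μ : Measure Ω)
    (a : ℕ → Ω → ℂ) : Prop where
  measurable : ∀ k, Measurable (a k)
  indep : iIndepFun a μ
  identDistrib : ∀ k, IdentDistrib (a k) (a 0) μ μ
  ae_ne_zero : ∀ᵐ ω ∂μ, a 0 ω ≠ 0
  not_deterministic : ¬ ∃ c : ℂ, ∀ᵐ ω ∂μ, a 0 ω = c
  integrable_log : Integrable (fun ω => Real.log (1 + ‖a 0 ω‖)) μ

/-- The polynomial `P_n(z) = ∑_{k=0}^n a_k z^k / ‖z^k‖_{n,ν}` with coefficients `a`. -/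
noncomputable def weightedPoly (ν : Measure ℂ) (n : ℕ) (a : ℕ → ℂ) (z : ℂ) : ℂ :=
  ∑ k ∈ Finset.range (n + 1), a k * (z ^ k / (monomialNorm ν n k : ℂ))

/-- The power series `∑_{k ≥ 0} a_k z^k`. -/
noncomputable def coeffSeries (a : ℕ → ℂ) (z : ℂ) : ℂ := ∑' k : ℕ, a k * z ^ k

/-! Averaging over circles and Jensen's formula write the potential of a rotation-invariant
measure as a constant plus the mean of the positive part of `log |z| - log |w|`. Hence
`‖z ^ k‖_{n,ν} ^ 2` is an exponential moment of `log |z|` under a measure that concentrates, as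
`n → ∞`, on the innermost circle of `supp ν`. When `D_R` is a component of the complement of the
support that circle has radius `R`, so that `‖z ^ k‖_{n,ν} / ‖1‖_{n,ν}` tends to `R ^ k` from
above for each fixed `k`, and the rescaled polynomials `P_n` converge locally uniformly on
`D_R`, by dominated convergence, to the power series evaluated at `z / R`. By Hurwitz's theorem
the zeros converge as well.

In the exterior of a disk the same argument is applied to the polynomials `z ^ (-n) P_n(z)` in
`R / z`, with reference norm `‖z ^ n‖_{n,ν}`. Their coefficients are `a_n, …, a_0`, which have the
same joint law as `a_0, …, a_n` by exchangeability. -/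

namespace PointConfig

section LinStat

variable {X : Type*} [TopologicalSpace X]

lemma finite_support_mult_mul (P : PointConfig X) {f : X → ℝ} (hf : HasCompactSupport f) :
    (Function.support fun x => (P.mult x : ℝ) * f x).Finite := by
  refine (P.locallyFinite.finite_inter_support_of_isCompact hf).subset fun x hx => ?_
  have h := mul_ne_zero_iff.1 hx
  exact ⟨subset_tsupport f h.2, Nat.cast_ne_zero.1 h.1⟩

lemma linStat_sub (P : PointConfig X) {f g : X → ℝ} (hf : HasCompactSupport f)
    (hg : HasCompactSupport g) : linStat (fun x => f x - g x) P = linStat f P - linStat g P := by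
  simp only [linStat, mul_sub]
  exact finsum_sub_distrib (P.finite_support_mult_mul hf) (P.finite_support_mult_mul hg)

lemma linStat_sum (P : PointConfig X) {ι : Type*} (s : Finset ι) {f : ι → X → ℝ}
    (hf : ∀ i ∈ s, HasCompactSupport (f i)) :
    linStat (fun x => ∑ i ∈ s, f i x) P = ∑ i ∈ s, linStat (f i) P := by
  simp only [linStat, Finset.mul_sum]
  exact finsum_sum_comm s _ fun i hi => P.finite_support_mult_mul (hf i hi)

lemma linStat_const_mul (P : PointConfig X) (c : ℝ) (f : X → ℝ) :
    linStat (fun x => c * f x) P = c * linStat f P := by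
  rw [linStat, linStat, ← smul_eq_mul c, smul_finsum]
  exact finsum_congr fun x => by simp only [smul_eq_mul]; ring

lemma linStat_mono (P : PointConfig X) {f g : X → ℝ} (hf : HasCompactSupport f)
    (hg : HasCompactSupport g) (h : ∀ x, P.mult x ≠ 0 → f x ≤ g x) :
    linStat f P ≤ linStat g P := by
  refine finsum_le_finsum' (P.finite_support_mult_mul hf) (P.finite_support_mult_mul hg)
    fun x => ?_
  rcases eq_or_ne (P.mult x) 0 with hx | hx
  · simp [hx]
  · exact mul_le_mul_of_nonneg_left (h x hx) (Nat.cast_nonneg _)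

lemma abs_linStat_sub_le (P : PointConfig X) {f g χ : X → ℝ} (hf : HasCompactSupport f)
    (hg : HasCompactSupport g) (hχ : HasCompactSupport χ) {ε : ℝ}
    (hle : ∀ x, P.mult x ≠ 0 → |f x - g x| ≤ ε * χ x) :
    |linStat f P - linStat g P| ≤ ε * linStat χ P := by
  have hεχ : HasCompactSupport fun x => ε * χ x := hχ.mul_left
  rw [abs_sub_le_iff, ← linStat_sub P hf hg, ← linStat_sub P hg hf, ← linStat_const_mul]
  exact ⟨linStat_mono P (hf.sub hg) hεχ fun x hx => (abs_sub_le_iff.1 (hle x hx)).1,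
    linStat_mono P (hg.sub hf) hεχ fun x hx => (abs_sub_le_iff.1 (hle x hx)).2⟩

lemma continuous_linStat (f : C_c(X, ℝ)) : Continuous (linStat f : PointConfig X → ℝ) :=
  continuous_iff_le_induced.2 (iInf_le _ f)

lemma nhds_eq_iInf_comap (P : PointConfig X) :
    𝓝 P = ⨅ f : C_c(X, ℝ), comap (linStat f) (𝓝 (linStat f P)) := by
  rw [nhds_iInf]
  exact iInf_congr fun f => nhds_induced _ _

variable {α : Type*} {l : Filter α} {Q : α → PointConfig X} {P : PointConfig X}

lemma tendsto_iff :
    Tendsto Q l (𝓝 P) ↔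
      ∀ f : C_c(X, ℝ), Tendsto (fun i => linStat f (Q i)) l (𝓝 (linStat f P)) := by
  simp only [nhds_eq_iInf_comap, tendsto_iInf, tendsto_comap_iff, Function.comp_def]

lemma tendsto_linStat_of_approx {f χ : X → ℝ}
    (hχ : Tendsto (fun i => linStat χ (Q i)) l (𝓝 (linStat χ P)))
    (h : ∀ ε > 0, ∃ d : X → ℝ, |linStat f P - linStat d P| ≤ ε * linStat χ P ∧
      (∀ᶠ i in l, |linStat f (Q i) - linStat d (Q i)| ≤ ε * linStat χ (Q i)) ∧
      Tendsto (fun i => linStat d (Q i)) l (𝓝 (linStat d P))) :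
    Tendsto (fun i => linStat f (Q i)) l (𝓝 (linStat f P)) := by
  rw [Metric.tendsto_nhds]
  intro ε hε
  obtain ⟨η, hη, hηε⟩ := exists_pos_mul_lt hε (linStat χ P + linStat χ P)
  obtain ⟨d, hdP, hdQ, hd⟩ := h η hη
  have hbound : Tendsto (fun i => η * linStat χ (Q i) + dist (linStat d (Q i)) (linStat d P)
      + η * linStat χ P) l (𝓝 (η * linStat χ P + 0 + η * linStat χ P)) :=
    ((hχ.const_mul η).add (tendsto_iff_dist_tendsto_zero.1 hd)).add_const _
  filter_upwards [hdQ, hbound.eventually_lt_const (by linarith : _ < ε)] with i hi hlt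
  refine lt_of_le_of_lt ?_ hlt
  rw [← Real.dist_eq] at hi hdP
  rw [dist_comm] at hdP
  exact (dist_triangle4 _ (linStat d (Q i)) (linStat d P) _).trans (by gcongr)

lemma tendsto_of_forall_exists_isOpen [T2Space X] [LocallyCompactSpace X]
    (h : ∀ x, ∃ V, IsOpen V ∧ x ∈ V ∧ ∀ φ : C_c(X, ℝ), tsupport φ ⊆ V →
      Tendsto (fun i => linStat φ (Q i)) l (𝓝 (linStat φ P))) :
    Tendsto Q l (𝓝 P) := by
  rw [tendsto_iff]
  intro φ
  choose V hVo hxV hV using h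
  have hφ := φ.hasCompactSupport
  obtain ⟨t, ht⟩ := hφ.isCompact.elim_finite_subcover V hVo fun x _ => Set.mem_iUnion.2 ⟨x, hxV x⟩
  obtain ⟨g, hg, hg1, -, -⟩ := exists_continuous_sum_one_of_isOpen_isCompact
    (s := fun j => V (t.equivFin.symm j)) (fun j => hVo _) hφ.isCompact (by
      intro x hx
      obtain ⟨y, hy, hxy⟩ := Set.mem_iUnion₂.1 (ht hx)
      exact Set.mem_iUnion.2 ⟨t.equivFin ⟨y, hy⟩, by simpa using hxy⟩)
  have hdecomp : (φ : X → ℝ) = fun x => ∑ j, g j x * φ x := by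
    ext x
    rw [← Finset.sum_mul]
    by_cases hx : x ∈ tsupport φ
    · rw [show ∑ j, g j x = 1 by simpa using hg1 hx, one_mul]
    · rw [image_eq_zero_of_notMem_tsupport hx, mul_zero]
  have hcs (j) : HasCompactSupport fun x => g j x * φ x := hφ.mul_left
  rw [hdecomp]
  simp only [fun P => linStat_sum P Finset.univ fun j _ => hcs j]
  exact tendsto_finsetSum _ fun j _ =>
    hV _ ⟨⟨_, (g j).continuous.mul φ.continuous⟩, hcs j⟩ (tsupport_mul_subset_left.trans (hg j))

end LinStat

section Countable

variable {X : Type*} [TopologicalSpace X] [T2Space X] [LocallyCompactSpace X]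
  [SecondCountableTopology X]

lemma exists_seq_approx {K : Set X} (hK : IsCompact K) :
    ∃ d : ℕ → C_c(X, ℝ), ∃ χ : C_c(X, ℝ), ∀ f : C_c(X, ℝ), tsupport f ⊆ K →
      ∀ ε > 0, ∃ k, ∀ x, |f x - d k x| ≤ ε * χ x := by
  obtain ⟨χ, hχ1, -, hχc, hχ⟩ := exists_continuous_one_zero_of_isCompact hK isClosed_empty
    (Set.disjoint_empty K)
  let A : Set C(X, ℝ) := {f | ∀ x ∉ K, f x = 0}
  have : Nonempty A := ⟨⟨0, fun x _ => rfl⟩⟩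
  refine ⟨fun k => ⟨TopologicalSpace.denseSeq A k,
    HasCompactSupport.intro hK (TopologicalSpace.denseSeq A k).2⟩, ⟨χ, hχc⟩, fun f hf ε hε => ?_⟩
  let fA : A := ⟨f, fun x hx => image_eq_zero_of_notMem_tsupport fun h => hx (hf h)⟩
  have hnhds : ∀ᶠ g : A in 𝓝 fA, ∀ x ∈ K, dist (f x) (g.1 x) < ε :=
    (continuous_subtype_val.tendsto fA).eventually <| Metric.tendstoUniformlyOn_iff.1
      (ContinuousMap.tendsto_iff_forall_isCompact_tendstoUniformlyOn.1 tendsto_id K hK) ε hε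
  obtain ⟨_, ⟨k, rfl⟩, hk⟩ := (TopologicalSpace.denseRange_denseSeq A).inter_nhds_nonempty hnhds
  refine ⟨k, fun x => ?_⟩
  change |fA.1 x - (TopologicalSpace.denseSeq A k).1 x| ≤ ε * χ x
  by_cases hx : x ∈ K
  · rw [hχ1 hx, Pi.one_apply, mul_one]
    exact (hk x hx).le
  · rw [fA.2 x hx, (TopologicalSpace.denseSeq A k).2 x hx, sub_zero, abs_zero]
    exact mul_nonneg hε.le (hχ x).1

lemma exists_isInducing_linStat :
    ∃ d : ℕ × Option ℕ → C_c(X, ℝ),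
      IsInducing (fun (P : PointConfig X) (i : ℕ × Option ℕ) => linStat (d i) P) := by
  let K := CompactExhaustion.choice X
  choose d χ hd using fun m => exists_seq_approx (K.isCompact m)
  let D : ℕ × Option ℕ → C_c(X, ℝ) := fun i => i.2.elim (χ i.1) (d i.1)
  let Φ (P : PointConfig X) (i : ℕ × Option ℕ) : ℝ := linStat (D i) P
  refine ⟨D, isInducing_iff_nhds.2 fun P => le_antisymm ?_ ?_⟩
  · rw [← tendsto_iff_comap]
    exact (continuous_pi fun i => continuous_linStat _).tendsto P
  refine tendsto_id'.1 (tendsto_iff.2 fun f => ?_)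
  have hD := tendsto_pi_nhds.1 (tendsto_comap (f := Φ) (x := 𝓝 (Φ P)))
  obtain ⟨m, hm⟩ := K.exists_superset_of_isCompact f.hasCompactSupport
  refine tendsto_linStat_of_approx (hD (m, none)) fun ε hε => ?_
  obtain ⟨k, hk⟩ := hd m f hm ε hε
  have happrox (Q : PointConfig X) :
      |linStat f Q - linStat (d m k) Q| ≤ ε * linStat (χ m) Q :=
    abs_linStat_sub_le Q f.hasCompactSupport (d m k).hasCompactSupport (χ m).hasCompactSupport
      fun x _ => hk x
  exact ⟨d m k, happrox P, .of_forall happrox, hD (m, some k)⟩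

instance : TopologicalSpace.PseudoMetrizableSpace (PointConfig X) :=
  (exists_isInducing_linStat (X := X)).choose_spec.pseudoMetrizableSpace

end Countable

end PointConfig

section Hurwitz

/-- The number of zeros of `f` in `K`, counted with multiplicity. Zeros of infinite order are not
counted, and the value is `0` if there are infinitely many zeros of finite order. -/
noncomputable def zeroCount (f : ℂ → ℂ) (K : Set ℂ) : ℕ :=
  ∑ᶠ u ∈ K, analyticOrderNatAt f u

lemma cast_zeroCount (f : ℂ → ℂ) (K : Set ℂ) :
    (zeroCount f K : ℝ) = ∑ᶠ u ∈ K, (analyticOrderNatAt f u : ℝ) := by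
  simp only [zeroCount, finsum_mem_def]
  refine ((Nat.castAddMonoidHom ℝ).map_finsum_of_injective Nat.cast_injective _).trans ?_
  exact finsum_congr fun u => by by_cases hu : u ∈ K <;> simp [hu]

lemma finite_inter_support_analyticOrderNatAt {f : ℂ → ℂ} {K : Set ℂ} (hK : IsCompact K)
    (hf : AnalyticOnNhd ℂ f K) : (K ∩ Function.support (analyticOrderNatAt f)).Finite := by
  refine (((locallyFiniteSupport_analyticOrder hf).finite_inter_support_of_isCompact
    (isCompact_iff_isCompact_univ.1 hK)).image Subtype.val).subset ?_
  exact fun u hu => ⟨⟨u, hu.1⟩, ⟨Set.mem_univ _, hu.2⟩, rfl⟩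

open MeromorphicOn in
/-- **Jensen's formula** for analytic functions, with the multiplicities of the zeros expressed by
the order of vanishing. -/
lemma circleAverage_log_norm_eq_finsum {f : ℂ → ℂ} {c : ℂ} {r : ℝ} (hr : 0 < r)
    (hf : AnalyticOnNhd ℂ f (Metric.closedBall c r)) :
    Real.circleAverage (fun z => Real.log ‖f z‖) c r
      = ∑ᶠ u ∈ Metric.closedBall c r, analyticOrderNatAt f u * (Real.log r - Real.log ‖c - u‖)
        + Real.log ‖meromorphicTrailingCoeffAt f c‖ := by
  have habs : |r| = r := abs_of_pos hr
  have hdiv (u : ℂ) : (divisor f (Metric.closedBall c r) u : ℝ)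
      = (Metric.closedBall c r).indicator (fun u => (analyticOrderNatAt f u : ℝ)) u := by
    by_cases hu : u ∈ Metric.closedBall c r
    · rw [hf.divisor_apply hu, Set.indicator_of_mem hu, analyticOrderNatAt]
      cases analyticOrderAt f u <;> simp
    · simp [Function.locallyFinsuppWithin.apply_eq_zero_of_notMem _ hu, hu]
  rw [MeromorphicOn.circleAverage_log_norm hr.ne' (by rw [habs]; exact hf.meromorphicOn), habs,
    ← countingFunction_finsum_eq_finsum_add hr.ne'
      ((divisor f _).finiteSupport (isCompact_closedBall c r)), finsum_mem_def]
  simp only [hdiv, Set.indicator_mul_left]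

lemma circleAverage_log_norm_sub_eq_zeroCount_mul {f : ℂ → ℂ} {c : ℂ} {r₁ r₂ : ℝ} (h₁ : 0 < r₁)
    (h₁₂ : r₁ ≤ r₂) (hf : AnalyticOnNhd ℂ f (Metric.closedBall c r₂))
    (hne : ∀ z ∈ Metric.closedBall c r₂, r₁ ≤ dist z c → f z ≠ 0) :
    Real.circleAverage (fun z => Real.log ‖f z‖) c r₂
        - Real.circleAverage (fun z => Real.log ‖f z‖) c r₁
      = zeroCount f (Metric.closedBall c r₁) * (Real.log r₂ - Real.log r₁) := by
  set Z := Metric.closedBall c r₁ ∩ Function.support (analyticOrderNatAt f)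
  have hf₁ := hf.mono (Metric.closedBall_subset_closedBall h₁₂)
  have hZ : Z.Finite := finite_inter_support_analyticOrderNatAt (isCompact_closedBall c r₁) hf₁
  have hmem {u : ℂ} (hu : analyticOrderNatAt f u ≠ 0) :
      (u ∈ Metric.closedBall c r₁ ↔ u ∈ Z) ∧ (u ∈ Metric.closedBall c r₂ ↔ u ∈ Z) := by
    refine ⟨⟨fun h => ⟨h, hu⟩, fun h => h.1⟩, fun h => ⟨?_, hu⟩,
      fun h => Metric.closedBall_subset_closedBall h₁₂ h.1⟩
    by_contra! hd
    exact hne u h (not_le.1 hd).le (apply_eq_zero_of_analyticOrderNatAt_ne_zero hu)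
  have hsupp {g : ℂ → ℝ} {u : ℂ}
      (hu : u ∈ Function.support fun v => (analyticOrderNatAt f v : ℝ) * g v) :
      analyticOrderNatAt f u ≠ 0 := Nat.cast_ne_zero.1 (left_ne_zero_of_mul hu)
  rw [circleAverage_log_norm_eq_finsum (h₁.trans_le h₁₂) hf,
    circleAverage_log_norm_eq_finsum h₁ hf₁, add_sub_add_right_eq_sub, cast_zeroCount,
    finsum_mem_mul,
    finsum_mem_inter_support_eq' _ _ Z fun u hu => (hmem (hsupp hu)).1,
    finsum_mem_inter_support_eq' _ _ Z fun u hu => (hmem (hsupp hu)).2,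
    finsum_mem_inter_support_eq' _ _ Z fun u hu => (hmem (hsupp hu)).1,
    ← finsum_mem_sub_distrib _ _ hZ]
  exact finsum_mem_congr rfl fun u _ => by ring

variable {ι : Type*} {l : Filter ι} {F : ι → ℂ → ℂ} {f : ℂ → ℂ}

lemma eventually_forall_ne_zero_of_tendstoUniformlyOn {K : Set ℂ} (hK : IsCompact K)
    (hf : ContinuousOn f K) (hne : ∀ z ∈ K, f z ≠ 0) (hlim : TendstoUniformlyOn F f l K) :
    ∀ᶠ i in l, ∀ z ∈ K, F i z ≠ 0 := by
  obtain ⟨m, hm, hmle⟩ := hK.exists_forall_le' hf.norm fun z hz => norm_pos_iff.2 (hne z hz)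
  filter_upwards [Metric.tendstoUniformlyOn_iff.1 hlim m hm] with i hi z hz h0
  exact (hi z hz).not_ge (by simpa [h0] using hmle z hz)

lemma tendstoUniformlyOn_log_norm {K : Set ℂ} (hK : IsCompact K)
    (hf : ContinuousOn f K) (hne : ∀ z ∈ K, f z ≠ 0) (hlim : TendstoUniformlyOn F f l K) :
    TendstoUniformlyOn (fun i z => Real.log ‖F i z‖) (fun z => Real.log ‖f z‖) l K := by
  rw [← tendstoLocallyUniformlyOn_iff_tendstoUniformlyOn_of_compact hK,
    tendstoLocallyUniformlyOn_iff_forall_tendsto] at hlim ⊢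
  intro x hx
  have hfx : Tendsto (fun y : ι × ℂ => f y.2) (l ×ˢ 𝓝[K] x) (𝓝 (f x)) :=
    (hf x hx).tendsto.comp tendsto_snd
  have hFx : Tendsto (fun y : ι × ℂ => F y.1 y.2) (l ×ˢ 𝓝[K] x) (𝓝 (f x)) :=
    hfx.congr_uniformity (hlim x hx)
  have hx0 : ‖f x‖ ≠ 0 := norm_ne_zero_iff.2 (hne x hx)
  exact ((hfx.norm.log hx0).prodMk_nhds (hFx.norm.log hx0)).mono_right (nhds_le_uniformity _)

variable [l.IsCountablyGenerated]

lemma tendsto_circleAverage_log_norm {c : ℂ} {r : ℝ} (hr : 0 ≤ r)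
    (hF : ∀ᶠ i in l, ContinuousOn (F i) (Metric.sphere c r))
    (hf : ContinuousOn f (Metric.sphere c r)) (hne : ∀ z ∈ Metric.sphere c r, f z ≠ 0)
    (hlim : TendstoUniformlyOn F f l (Metric.sphere c r)) :
    Tendsto (fun i => Real.circleAverage (fun z => Real.log ‖F i z‖) c r) l
      (𝓝 (Real.circleAverage (fun z => Real.log ‖f z‖) c r)) := by
  have hK := isCompact_sphere c r
  have hmaps : Set.MapsTo (circleMap c r) (Set.uIcc 0 (2 * Real.pi)) (Metric.sphere c r) :=
    fun θ _ => circleMap_mem_sphere c hr θ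
  simp only [Real.circleAverage_def]
  refine Tendsto.const_smul (TendstoUniformlyOn.tendsto_intervalIntegral_of_continuousOn ?_ ?_) _
  · filter_upwards [hF, eventually_forall_ne_zero_of_tendstoUniformlyOn hK hf hne hlim]
      with i hi hne
    exact (hi.norm.log fun z hz => norm_ne_zero_iff.2 (hne z hz)).comp
      (continuous_circleMap c r).continuousOn hmaps
  · exact ((tendstoUniformlyOn_log_norm hK hf hne hlim).comp _).mono hmaps

/-- **Hurwitz's theorem** for a disk: the difference of two circle averages of `log ‖F i‖` is a
multiple of the number of zeros, so that its convergence forces that number to stabilize. -/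
lemma eventually_zeroCount_eq {c : ℂ} {r₁ r₂ : ℝ} (h₁ : 0 < r₁) (h₁₂ : r₁ < r₂)
    (hF : ∀ᶠ i in l, AnalyticOnNhd ℂ (F i) (Metric.closedBall c r₂))
    (hf : AnalyticOnNhd ℂ f (Metric.closedBall c r₂))
    (hne : ∀ z ∈ Metric.closedBall c r₂, r₁ ≤ dist z c → f z ≠ 0)
    (hlim : TendstoUniformlyOn F f l (Metric.closedBall c r₂)) :
    ∀ᶠ i in l, (∀ z ∈ Metric.closedBall c r₂, r₁ ≤ dist z c → F i z ≠ 0) ∧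
      zeroCount (F i) (Metric.closedBall c r₁) = zeroCount f (Metric.closedBall c r₁) := by
  set A := Metric.closedBall c r₂ ∩ {z | r₁ ≤ dist z c}
  have hA : IsCompact A := (isCompact_closedBall c r₂).inter_right
    (isClosed_le continuous_const (continuous_id.dist continuous_const))
  have hneF : ∀ᶠ i in l, ∀ z ∈ A, F i z ≠ 0 :=
    eventually_forall_ne_zero_of_tendstoUniformlyOn hA
      (hf.continuousOn.mono Set.inter_subset_left) (fun z hz => hne z hz.1 hz.2)
      (hlim.mono Set.inter_subset_left)
  have havg {r : ℝ} (hr₁ : r₁ ≤ r) (hr₂ : r ≤ r₂) :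
      Tendsto (fun i => Real.circleAverage (fun z => Real.log ‖F i z‖) c r) l
        (𝓝 (Real.circleAverage (fun z => Real.log ‖f z‖) c r)) := by
    have hsub : Metric.sphere c r ⊆ Metric.closedBall c r₂ :=
      Metric.sphere_subset_closedBall.trans (Metric.closedBall_subset_closedBall hr₂)
    exact tendsto_circleAverage_log_norm (h₁.le.trans hr₁)
      (hF.mono fun i hi => hi.continuousOn.mono hsub) (hf.continuousOn.mono hsub)
      (fun z hz => hne z (hsub hz) (hr₁.trans_eq (Metric.mem_sphere.1 hz).symm)) (hlim.mono hsub)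
  have hL : Real.log r₂ - Real.log r₁ ≠ 0 := (sub_pos.2 (Real.log_lt_log h₁ h₁₂)).ne'
  have hcount : Tendsto (fun i => (zeroCount (F i) (Metric.closedBall c r₁) : ℝ)) l
      (𝓝 (zeroCount f (Metric.closedBall c r₁))) := by
    rw [eq_div_of_mul_eq hL (circleAverage_log_norm_sub_eq_zeroCount_mul h₁ h₁₂.le hf hne).symm]
    refine (((havg h₁₂.le le_rfl).sub (havg le_rfl h₁₂.le)).div_const _).congr' ?_
    filter_upwards [hF, hneF] with i hi hnei
    rw [circleAverage_log_norm_sub_eq_zeroCount_mul h₁ h₁₂.le hi fun z hz hz' => hnei z ⟨hz, hz'⟩,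
      mul_div_cancel_right₀ _ hL]
  have hcountℕ := Nat.isClosedEmbedding_coe_real.tendsto_nhds_iff.2 hcount
  rw [nhds_discrete, tendsto_pure] at hcountℕ
  filter_upwards [hneF, hcountℕ] with i hi hci using ⟨fun z hz hz' => hi z ⟨hz, hz'⟩, hci⟩

variable {U : Set ℂ}

lemma zerosIn_mult (hf : AnalyticOnNhd ℂ f U) (x : U) :
    (zerosIn U f).mult x = analyticOrderNatAt f x := by
  rw [zerosIn, dif_pos hf]

lemma linStat_indicator_zerosIn (hf : AnalyticOnNhd ℂ f U) {K : Set ℂ} (hK : K ⊆ U) :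
    PointConfig.linStat ((Subtype.val ⁻¹' K).indicator 1) (zerosIn U f) = zeroCount f K := by
  set g : ℂ → ℝ := K.indicator fun u => analyticOrderNatAt f u
  have hg (x : U) : (zerosIn U f).mult x * (Subtype.val ⁻¹' K).indicator (1 : U → ℝ) x = g x := by
    rw [zerosIn_mult hf]
    by_cases hx : (x : ℂ) ∈ K <;> simp [g, hx]
  rw [PointConfig.linStat, finsum_congr hg, finsum_set_coe_eq_finsum_mem, cast_zeroCount,
    finsum_mem_def, Set.indicator_indicator, Set.inter_eq_self_of_subset_right hK,
    ← finsum_mem_def]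

lemma hasCompactSupport_of_forall_notMem_eq_zero {K : Set ℂ} (hK : IsCompact K) (hKU : K ⊆ U)
    {φ : U → ℝ} (hφ : ∀ y : U, (y : ℂ) ∉ K → φ y = 0) : HasCompactSupport φ :=
  HasCompactSupport.intro
    ((IsInducing.subtypeVal.isCompact_preimage_iff (by simpa using hKU)).2 hK) hφ

lemma abs_linStat_zerosIn_sub_le (hf : AnalyticOnNhd ℂ f U) {K L : Set ℂ} (hL : IsCompact L)
    (hKL : K ⊆ L) (hLU : L ⊆ U) (hne : ∀ z ∈ L \ K, f z ≠ 0) {φ : U → ℝ} {t ε : ℝ}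
    (hφL : ∀ y : U, (y : ℂ) ∉ L → φ y = 0) (hφK : ∀ y : U, (y : ℂ) ∈ K → |φ y - t| ≤ ε) :
    |PointConfig.linStat φ (zerosIn U f) - PointConfig.linStat
        (fun y => t * (Subtype.val ⁻¹' K).indicator 1 y) (zerosIn U f)|
      ≤ ε * PointConfig.linStat ((Subtype.val ⁻¹' L).indicator 1) (zerosIn U f) := by
  have hcs {φ : U → ℝ} := hasCompactSupport_of_forall_notMem_eq_zero (φ := φ) hL hLU
  refine PointConfig.abs_linStat_sub_le _ (hcs hφL) (hcs fun y hy => ?_) (hcs fun y hy => ?_)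
    fun y hy => ?_
  · simp [mt (@hKL y) hy]
  · simp [hy]
  · by_cases hyL : (y : ℂ) ∈ L
    · have hyK : (y : ℂ) ∈ K := by
        by_contra hyK
        rw [zerosIn_mult hf] at hy
        exact hne y ⟨hyL, hyK⟩ (apply_eq_zero_of_analyticOrderNatAt_ne_zero hy)
      simpa [hyL, hyK] using hφK y hyK
    · simp [hφL y hyL, hyL, mt (@hKL y) hyL]

lemma tendsto_linStat_zerosIn (hF : ∀ᶠ i in l, AnalyticOnNhd ℂ (F i) U)
    (hf : AnalyticOnNhd ℂ f U) {x : U} {r r₀ : ℝ} (hr : 0 < r) (hr₀ : r < r₀)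
    (hsub : Metric.closedBall (x : ℂ) r₀ ⊆ U)
    (hlim : TendstoUniformlyOn F f l (Metric.closedBall (x : ℂ) r₀))
    (hne : ∀ z ∈ Metric.closedBall (x : ℂ) r₀, z ≠ x → f z ≠ 0) {φ : U → ℝ}
    (hφ : ContinuousAt φ x) (hφ0 : ∀ y : U, (y : ℂ) ∉ Metric.closedBall (x : ℂ) r → φ y = 0) :
    Tendsto (fun i => PointConfig.linStat φ (zerosIn U (F i))) l
      (𝓝 (PointConfig.linStat φ (zerosIn U f))) := by
  have hball {s : ℝ} (hs : s < r₀) : Metric.closedBall (x : ℂ) s ⊆ Metric.closedBall (x : ℂ) r₀ :=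
    Metric.closedBall_subset_closedBall hs.le
  have hfne {s : ℝ} (hs : 0 < s) (z : ℂ) (hz : z ∈ Metric.closedBall (x : ℂ) r₀)
      (hsz : s ≤ dist z x) : f z ≠ 0 := hne z hz (dist_pos.1 (hs.trans_le hsz))
  have hurwitz {s : ℝ} (hs : 0 < s) (hs₀ : s < r₀) := eventually_zeroCount_eq hs hs₀
    (hF.mono fun i hi => hi.mono hsub) (hf.mono hsub) (hfne hs) hlim
  have hind {s : ℝ} (hs : 0 < s) (hs₀ : s < r₀) :
      Tendsto (fun i => PointConfig.linStat
        ((Subtype.val ⁻¹' Metric.closedBall (x : ℂ) s).indicator 1) (zerosIn U (F i))) l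
        (𝓝 (PointConfig.linStat
          ((Subtype.val ⁻¹' Metric.closedBall (x : ℂ) s).indicator 1) (zerosIn U f))) := by
    refine tendsto_const_nhds.congr' ?_
    filter_upwards [hF, hurwitz hs hs₀] with i hFi hi
    rw [linStat_indicator_zerosIn hFi ((hball hs₀).trans hsub), hi.2,
      linStat_indicator_zerosIn hf ((hball hs₀).trans hsub)]
  refine PointConfig.tendsto_linStat_of_approx (hind hr hr₀) fun ε hε => ?_
  obtain ⟨δ, hδ, hφδ⟩ := Metric.continuousAt_iff.1 hφ ε hε
  obtain ⟨s, hs, hsmin⟩ := exists_between (lt_min hδ hr)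
  have hsr : s < r := hsmin.trans_le (min_le_right _ _)
  have hφs (y : U) (hy : (y : ℂ) ∈ Metric.closedBall (x : ℂ) s) : |φ y - φ x| ≤ ε :=
    (hφδ ((Metric.mem_closedBall.1 hy).trans_lt (hsmin.trans_le (min_le_left _ _)))).le
  have happrox {g : ℂ → ℂ} (hg : AnalyticOnNhd ℂ g U)
      (hgne : ∀ z ∈ Metric.closedBall (x : ℂ) r₀, s ≤ dist z x → g z ≠ 0) :=
    abs_linStat_zerosIn_sub_le hg (isCompact_closedBall (x : ℂ) r)
      (Metric.closedBall_subset_closedBall hsr.le) ((hball hr₀).trans hsub)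
      (fun z hz => hgne z (hball hr₀ hz.1) (not_le.1 hz.2).le) hφ0 hφs
  refine ⟨fun y => φ x * (Subtype.val ⁻¹' Metric.closedBall (x : ℂ) s).indicator 1 y,
    happrox hf (hfne hs), ?_, ?_⟩
  · filter_upwards [hF, hurwitz hs (hsr.trans hr₀)] with i hFi hi using happrox hFi hi.1
  · simp only [PointConfig.linStat_const_mul]
    exact (hind hs (hsr.trans hr₀)).const_mul _

/-- **Hurwitz's theorem**: the zeros depend continuously, in the vague topology, on the
holomorphic function in the topology of locally uniform convergence. -/
theorem tendsto_zerosIn (hU : IsOpen U) (hF : ∀ᶠ i in l, AnalyticOnNhd ℂ (F i) U)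
    (hf : AnalyticOnNhd ℂ f U) (hlim : TendstoLocallyUniformlyOn F f l U)
    (hne : ∀ x ∈ U, analyticOrderAt f x ≠ ⊤) :
    Tendsto (fun i => zerosIn U (F i)) l (𝓝 (zerosIn U f)) := by
  have : LocallyCompactSpace U := hU.locallyCompactSpace
  refine PointConfig.tendsto_of_forall_exists_isOpen fun x => ?_
  have hisolated : ∀ᶠ z in 𝓝 (x : ℂ), z ∈ U ∧ (z ≠ x → f z ≠ 0) :=
    (hU.eventually_mem x.2).and <| eventually_nhdsWithin_iff.1 <|
      (hf x x.2).eventually_eq_zero_or_eventually_ne_zero.resolve_left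
        fun h => hne x x.2 (analyticOrderAt_eq_top.2 h)
  obtain ⟨r₀, hr₀, hball⟩ := Metric.nhds_basis_closedBall.mem_iff.1 hisolated
  have hsub : Metric.closedBall (x : ℂ) r₀ ⊆ U := fun z hz => (hball hz).1
  refine ⟨Metric.ball x (r₀ / 2), Metric.isOpen_ball, Metric.mem_ball_self (half_pos hr₀),
    fun φ hφ => tendsto_linStat_zerosIn hF hf (half_pos hr₀) (half_lt_self hr₀) hsub ?_
      (fun z hz => (hball hz).2) φ.continuous.continuousAt fun y hy => ?_⟩
  · exact (tendstoLocallyUniformlyOn_iff_forall_isCompact hU).1 hlim _ hsub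
      (isCompact_closedBall _ _)
  · exact image_eq_zero_of_notMem_tsupport fun h => hy (Metric.ball_subset_closedBall (hφ h))

end Hurwitz

section Potential

lemma abs_log_eq_two_mul_posLog_sub_log (x : ℝ) :
    |Real.log x| = 2 * Real.posLog x - Real.log x := by
  rw [← Real.half_mul_log_add_log_abs]
  ring

lemma integral_log_norm_circleMap_sub {r : ℝ} (hr : r ≠ 0) (w : ℂ) :
    ∫ θ in Set.Ioc 0 (2 * Real.pi), Real.log ‖circleMap 0 r θ - w‖
      = 2 * Real.pi * (Real.log r + Real.posLog (r⁻¹ * ‖w‖)) := by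
  have h := circleAverage_log_norm_sub_const_eq_log_radius_add_posLog (a := w) (c := 0) hr
  rwa [Real.circleAverage, intervalIntegral.integral_of_le Real.two_pi_pos.le, zero_sub, norm_neg,
    smul_eq_mul, inv_mul_eq_iff_eq_mul₀ Real.two_pi_pos.ne'] at h

lemma integrableOn_log_norm_circleMap_sub (r : ℝ) (w : ℂ) :
    IntegrableOn (fun θ => Real.log ‖circleMap 0 r θ - w‖) (Set.Ioc 0 (2 * Real.pi)) := by
  have h : CircleIntegrable (fun z => Real.log ‖z - w‖) 0 r := circleIntegrable_log_norm_sub_const r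
  rwa [CircleIntegrable, intervalIntegrable_iff_integrableOn_Ioc_of_le Real.two_pi_pos.le] at h

lemma integrableOn_posLog_norm_circleMap_sub (r : ℝ) (w : ℂ) :
    IntegrableOn (fun θ => Real.posLog ‖circleMap 0 r θ - w‖) (Set.Ioc 0 (2 * Real.pi)) := by
  have h : Continuous fun θ => Real.posLog ‖circleMap 0 r θ - w‖ :=
    Real.continuous_posLog.comp ((continuous_circleMap 0 r).sub continuous_const).norm
  exact h.integrableOn_Ioc

lemma integral_posLog_norm_circleMap_sub_le (r : ℝ) (w : ℂ) :
    ∫ θ in Set.Ioc 0 (2 * Real.pi), Real.posLog ‖circleMap 0 r θ - w‖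
      ≤ 2 * Real.pi * (Real.posLog r + Real.posLog ‖w‖ + Real.log 2) := by
  calc _ ≤ ∫ _ in Set.Ioc 0 (2 * Real.pi), (Real.posLog r + Real.posLog ‖w‖ + Real.log 2) := by
        refine integral_mono (integrableOn_posLog_norm_circleMap_sub r w) (integrable_const _)
          fun θ => ?_
        simpa [← sub_eq_add_neg] using Real.posLog_norm_add_le (circleMap 0 r θ) (-w)
    _ = _ := by simp [Real.pi_pos.le]

lemma integral_abs_log_norm_circleMap_sub_le {r : ℝ} (hr : r ≠ 0) (w : ℂ) :
    ∫ θ in Set.Ioc 0 (2 * Real.pi), |Real.log ‖circleMap 0 r θ - w‖|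
      ≤ 2 * (2 * Real.pi * (Real.posLog r + Real.posLog ‖w‖ + Real.log 2))
        - 2 * Real.pi * Real.log r := by
  simp only [abs_log_eq_two_mul_posLog_sub_log]
  rw [integral_sub ((integrableOn_posLog_norm_circleMap_sub r w).const_mul 2)
    (integrableOn_log_norm_circleMap_sub r w), integral_log_norm_circleMap_sub hr,
    integral_const_mul]
  have h := integral_posLog_norm_circleMap_sub_le r w
  have h₀ : 0 ≤ 2 * Real.pi * Real.posLog (r⁻¹ * ‖w‖) :=
    mul_nonneg Real.two_pi_pos.le Real.posLog_nonneg
  linarith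

namespace IsBackground

variable {ν : Measure ℂ} (hν : IsBackground ν)
include hν

lemma logPotential_mul {c : ℂ} (hc : ‖c‖ = 1) (z : ℂ) :
    logPotential ν (c * z) = logPotential ν z := by
  have hmeas : Measurable fun w : ℂ => Real.log ‖c * z - w‖ :=
    Real.measurable_log.comp (by fun_prop)
  rw [logPotential, ← hν.rotationInvariant c hc,
    integral_map (by fun_prop) hmeas.aestronglyMeasurable, hν.rotationInvariant c hc, logPotential]
  simp only [← mul_sub, norm_mul, hc, one_mul]

lemma logPotential_circleMap {z : ℂ} (hz : z ≠ 0) (θ : ℝ) :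
    logPotential ν (circleMap 0 ‖z‖ θ) = logPotential ν z := by
  rw [← div_mul_cancel₀ (circleMap 0 ‖z‖ θ) hz]
  exact hν.logPotential_mul (by simp [hz]) z

lemma ae_ne_zero : ∀ᵐ z ∂ν, z ≠ 0 := by
  rw [ae_iff]
  simpa using hν.zero_not_atom

lemma integrable_posLog_norm : Integrable (fun w : ℂ => Real.posLog ‖w‖) ν := by
  refine hν.integrable_log.mono (Real.continuous_posLog.comp continuous_norm).aestronglyMeasurable
    (Eventually.of_forall fun w => ?_)
  rw [Real.norm_eq_abs, Real.norm_eq_abs, abs_of_nonneg Real.posLog_nonneg, Real.posLog_apply]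
  exact max_le (abs_nonneg _) (le_abs_self _)

variable [IsProbabilityMeasure ν]

lemma integrable_prod_log_norm_circleMap_sub {r : ℝ} (hr : r ≠ 0) :
    Integrable (fun p : ℝ × ℂ => Real.log ‖circleMap 0 r p.1 - p.2‖)
      ((volume.restrict (Set.Ioc 0 (2 * Real.pi))).prod ν) := by
  have hmeas : Measurable fun p : ℝ × ℂ => Real.log ‖circleMap 0 r p.1 - p.2‖ := by
    refine Real.measurable_log.comp (Continuous.measurable ?_)
    exact (((continuous_circleMap 0 r).comp continuous_fst).sub continuous_snd).norm
  rw [integrable_prod_iff' hmeas.aestronglyMeasurable]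
  refine ⟨Eventually.of_forall fun w => integrableOn_log_norm_circleMap_sub r w,
    Integrable.mono' (g := fun w => 2 * (2 * Real.pi * (Real.posLog r + Real.posLog ‖w‖
      + Real.log 2)) - 2 * Real.pi * Real.log r) ?_
      hmeas.norm.stronglyMeasurable.integral_prod_left'.aestronglyMeasurable
      (Eventually.of_forall fun w => ?_)⟩
  · exact (((((integrable_const _).add hν.integrable_posLog_norm).add
      (integrable_const _)).const_mul _).const_mul _).sub (integrable_const _)
  · rw [Real.norm_of_nonneg (integral_nonneg fun _ => norm_nonneg _)]
    exact integral_abs_log_norm_circleMap_sub_le hr w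

/-- Averaging over rotations replaces the logarithm in the potential by its mean over a circle,
which Jensen's formula evaluates. -/
lemma logPotential_eq_integral_posLog {z : ℂ} (hz : z ≠ 0) :
    logPotential ν z = ∫ w, (Real.log ‖z‖ + Real.posLog (‖z‖⁻¹ * ‖w‖)) ∂ν := by
  have hr : ‖z‖ ≠ 0 := norm_ne_zero_iff.2 hz
  refine mul_left_cancel₀ Real.two_pi_pos.ne' ?_
  calc 2 * Real.pi * logPotential ν z
      = ∫ θ in Set.Ioc 0 (2 * Real.pi), logPotential ν (circleMap 0 ‖z‖ θ) := by
        simp [hν.logPotential_circleMap hz, Real.pi_pos.le]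
    _ = ∫ w, (∫ θ in Set.Ioc 0 (2 * Real.pi), Real.log ‖circleMap 0 ‖z‖ θ - w‖) ∂ν :=
        integral_integral_swap (hν.integrable_prod_log_norm_circleMap_sub hr)
    _ = _ := by simp only [integral_log_norm_circleMap_sub hr, integral_const_mul]

end IsBackground

end Potential

section Concentration

variable {X : Type*} [MeasurableSpace X]

/-- The mean excess of `s x` over an independent value of `s`. The potential of a rotationally
invariant measure is of this form, with `s` the logarithmic distance to a circle. -/
noncomputable def meanExcess (ν : Measure X) (s : X → ℝ) (x : X) : ℝ :=
  ∫ y, max (s x - s y) 0 ∂ν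

/-- The exponential weight of rate `q` in `s`, penalized at rate `t` by the mean excess. -/
noncomputable def penalizedWeight (ν : Measure X) (s : X → ℝ) (t q : ℝ) (x : X) : ℝ :=
  Real.exp (q * s x - t * meanExcess ν s x)

/-- The exponential moment of order `q` of `s`, penalized at rate `t` by the mean excess. -/
noncomputable def penalizedMoment (ν : Measure X) (s : X → ℝ) (t q : ℝ) : ℝ :=
  ∫ x, penalizedWeight ν s t q x ∂ν

/-- The penalized `L²` norm of order `0` divided by the one of order `j`, truncated to the degrees
`j ≤ n`. -/
noncomputable def momentRatio (ν : Measure X) (s : X → ℝ) (n j : ℕ) : ℝ :=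
  if j ≤ n then √(penalizedMoment ν s (2 * n) 0 / penalizedMoment ν s (2 * n) (2 * j)) else 0

variable {ν : Measure X} {s : X → ℝ} {t q : ℝ}

lemma meanExcess_nonneg (x : X) : 0 ≤ meanExcess ν s x :=
  integral_nonneg fun _ => le_max_right _ _

lemma measurable_meanExcess [SFinite ν] (hs : Measurable s) : Measurable (meanExcess ν s) := by
  have h : Measurable fun p : X × X => max (s p.1 - s p.2) 0 := by fun_prop
  exact h.stronglyMeasurable.integral_prod_right'.measurable

lemma penalizedWeight_pos (x : X) : 0 < penalizedWeight ν s t q x := Real.exp_pos _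

lemma measurable_penalizedWeight [SFinite ν] (hs : Measurable s) :
    Measurable (penalizedWeight ν s t q) :=
  Real.measurable_exp.comp ((hs.const_mul q).sub ((measurable_meanExcess hs).const_mul t))

lemma penalizedMoment_nonneg : 0 ≤ penalizedMoment ν s t q :=
  integral_nonneg fun x => (penalizedWeight_pos x).le

lemma support_ofReal_momentRatio_subset (n : ℕ) :
    (Function.support fun j => (momentRatio ν s n j : ℂ)) ⊆ Set.Iic n :=
  Function.support_subset_iff'.2 fun _ hj => Complex.ofReal_eq_zero.2 (if_neg hj)

variable [IsProbabilityMeasure ν]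

lemma integrable_max_sub (hi : Integrable s ν) (x : X) :
    Integrable (fun y => max (s x - s y) 0) ν :=
  ((integrable_const _).sub hi).pos_part

lemma sub_integral_le_meanExcess (hi : Integrable s ν) (x : X) :
    s x - ∫ y, s y ∂ν ≤ meanExcess ν s x := by
  calc s x - ∫ y, s y ∂ν = ∫ y, (s x - s y) ∂ν := by simp [integral_sub (integrable_const _) hi]
    _ ≤ _ := integral_mono ((integrable_const _).sub hi) (integrable_max_sub hi x)
        fun y => le_max_left _ _

lemma meanExcess_le (hi : Integrable s ν) (h0 : ∀ᵐ y ∂ν, 0 ≤ s y) {x : X} (hx : 0 ≤ s x) :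
    meanExcess ν s x ≤ s x := by
  calc meanExcess ν s x ≤ ∫ _, s x ∂ν :=
        integral_mono_ae (integrable_max_sub hi x) (integrable_const _)
          (h0.mono fun y hy => max_le (by linarith) hx)
    _ = s x := by simp

lemma mul_measureReal_lt_le_meanExcess (hi : Integrable s ν) {η ε : ℝ} (hη : η ≤ ε) {x : X}
    (hx : ε ≤ s x) : (ε - η) * ν.real {y | s y < η} ≤ meanExcess ν s x := by
  calc (ε - η) * ν.real {y | s y < η}
      ≤ (ε - η) * ν.real {y | ε - η ≤ max (s x - s y) 0} := by
        refine mul_le_mul_of_nonneg_left (measureReal_mono fun y hy => ?_) (sub_nonneg.2 hη)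
        exact le_max_of_le_left (sub_le_sub hx (show s y < η from hy).le)
    _ ≤ meanExcess ν s x :=
        mul_meas_ge_le_integral_of_nonneg (Eventually.of_forall fun _ => le_max_right _ _)
          (integrable_max_sub hi x) _

lemma penalizedWeight_le (hi : Integrable s ν) (hq : 0 ≤ q) (x : X) :
    penalizedWeight ν s t q x ≤ Real.exp (q * ∫ y, s y ∂ν - (t - q) * meanExcess ν s x) := by
  refine Real.exp_le_exp.2 ?_
  linarith [mul_le_mul_of_nonneg_left (sub_integral_le_meanExcess hi x) hq]

lemma integrable_penalizedWeight (hs : Measurable s) (hi : Integrable s ν) (hq : 0 ≤ q)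
    (hqt : q ≤ t) : Integrable (penalizedWeight ν s t q) ν := by
  refine Integrable.of_bound (C := Real.exp (q * ∫ y, s y ∂ν))
    (measurable_penalizedWeight hs).aestronglyMeasurable (Eventually.of_forall fun x => ?_)
  rw [Real.norm_of_nonneg (penalizedWeight_pos x).le]
  refine (penalizedWeight_le hi hq x).trans (Real.exp_le_exp.2 (sub_le_self _ ?_))
  exact mul_nonneg (sub_nonneg.2 hqt) (meanExcess_nonneg x)

lemma penalizedMoment_pos (hs : Measurable s) (hi : Integrable s ν) (hq : 0 ≤ q) (hqt : q ≤ t) :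
    0 < penalizedMoment ν s t q :=
  integral_exp_pos (integrable_penalizedWeight hs hi hq hqt)

lemma penalizedMoment_zero_le (hs : Measurable s) (hi : Integrable s ν) (h0 : ∀ᵐ y ∂ν, 0 ≤ s y)
    (hq : 0 ≤ q) (hqt : q ≤ t) : penalizedMoment ν s t 0 ≤ penalizedMoment ν s t q :=
  integral_mono_ae (integrable_penalizedWeight hs hi le_rfl (hq.trans hqt))
    (integrable_penalizedWeight hs hi hq hqt) <| h0.mono fun _ hx => Real.exp_le_exp.2 (by gcongr)

lemma exp_mul_measureReal_lt_le_penalizedMoment (hs : Measurable s) (hi : Integrable s ν)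
    (h0 : ∀ᵐ y ∂ν, 0 ≤ s y) (ht : 0 ≤ t) (η : ℝ) :
    Real.exp (-(t * η)) * ν.real {y | s y < η} ≤ penalizedMoment ν s t 0 := by
  have hsub : {y | s y < η} ≤ᵐ[ν] {y | Real.exp (-(t * η)) ≤ penalizedWeight ν s t 0 y} := by
    filter_upwards [h0] with y hy hyη
    refine Real.exp_le_exp.2 ?_
    rw [zero_mul, zero_sub, neg_le_neg_iff]
    exact mul_le_mul_of_nonneg_left ((meanExcess_le hi h0 hy).trans hyη.le) ht
  calc Real.exp (-(t * η)) * ν.real {y | s y < η}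
      ≤ Real.exp (-(t * η)) * ν.real {y | Real.exp (-(t * η)) ≤ penalizedWeight ν s t 0 y} :=
        mul_le_mul_of_nonneg_left (ENNReal.toReal_mono (measure_ne_top _ _) (measure_mono_ae hsub))
          (Real.exp_pos _).le
    _ ≤ penalizedMoment ν s t 0 :=
        mul_meas_ge_le_integral_of_nonneg (Eventually.of_forall fun x => (penalizedWeight_pos x).le)
          (integrable_penalizedWeight hs hi le_rfl ht) _

lemma penalizedMoment_le (hs : Measurable s) (hi : Integrable s ν) {ε δ : ℝ}
    (hδ : ∀ x, ε ≤ s x → δ ≤ meanExcess ν s x) (hq : 0 ≤ q) (hqt : q ≤ t) :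
    penalizedMoment ν s t q ≤ Real.exp (q * ε) * penalizedMoment ν s t 0
      + Real.exp (q * ∫ y, s y ∂ν - (t - q) * δ) := by
  have hi0 := integrable_penalizedWeight (ν := ν) hs hi le_rfl (hq.trans hqt)
  have hle (x : X) : penalizedWeight ν s t q x ≤ Real.exp (q * ε) * penalizedWeight ν s t 0 x
      + Real.exp (q * ∫ y, s y ∂ν - (t - q) * δ) := by
    rcases le_total ε (s x) with hx | hx
    · refine le_add_of_nonneg_of_le (mul_pos (Real.exp_pos _) (penalizedWeight_pos x)).le
        ((penalizedWeight_le hi hq x).trans (Real.exp_le_exp.2 ?_))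
      exact sub_le_sub_left (mul_le_mul_of_nonneg_left (hδ x hx) (sub_nonneg.2 hqt)) _
    · refine le_add_of_le_of_nonneg ?_ (Real.exp_pos _).le
      rw [penalizedWeight, penalizedWeight, ← Real.exp_add, Real.exp_le_exp]
      linarith [mul_le_mul_of_nonneg_left hx hq]
  calc penalizedMoment ν s t q
      ≤ ∫ x, (Real.exp (q * ε) * penalizedWeight ν s t 0 x
          + Real.exp (q * ∫ y, s y ∂ν - (t - q) * δ)) ∂ν :=
        integral_mono (integrable_penalizedWeight hs hi hq hqt)
          ((hi0.const_mul _).add (integrable_const _)) hle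
    _ = _ := by
        rw [integral_add (hi0.const_mul _) (integrable_const _), integral_const_mul]
        simp [penalizedMoment]

lemma penalizedMoment_div_le (hs : Measurable s) (hi : Integrable s ν)
    (h0 : ∀ᵐ y ∂ν, 0 ≤ s y) {ε δ η : ℝ} (hδ : ∀ x, ε ≤ s x → δ ≤ meanExcess ν s x)
    (hη : 0 < ν.real {y | s y < η}) (hq : 0 ≤ q) (hqt : q ≤ t) :
    penalizedMoment ν s t q / penalizedMoment ν s t 0 ≤ Real.exp (q * ε)
      + Real.exp (q * ∫ y, s y ∂ν + q * δ) / ν.real {y | s y < η}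
        * Real.exp (-(t * (δ - η))) := by
  have ht : 0 ≤ t := hq.trans hqt
  have hpos := penalizedMoment_pos (ν := ν) hs hi le_rfl ht
  have hexp : Real.exp (q * ∫ y, s y ∂ν - (t - q) * δ)
      = Real.exp (q * ∫ y, s y ∂ν + q * δ) * Real.exp (-(t * (δ - η))) * Real.exp (-(t * η)) := by
    rw [← Real.exp_add, ← Real.exp_add]
    ring_nf
  rw [div_le_iff₀ hpos, add_mul]
  refine (penalizedMoment_le hs hi hδ hq hqt).trans (add_le_add_right ?_ _)
  rw [hexp, div_mul_eq_mul_div, div_mul_eq_mul_div, le_div_iff₀ hη, mul_assoc]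
  exact mul_le_mul_of_nonneg_left (exp_mul_measureReal_lt_le_penalizedMoment hs hi h0 ht η)
    (by positivity)

/-- As `t → ∞` the penalized measures concentrate where `s` is close to its essential infimum `0`,
so that the factor `exp (q * s)` becomes irrelevant. -/
lemma tendsto_penalizedMoment_div (hs : Measurable s) (hi : Integrable s ν)
    (h0 : ∀ᵐ y ∂ν, 0 ≤ s y) (hpos : ∀ ε > 0, 0 < ν {y | s y < ε}) (hq : 0 ≤ q) :
    Tendsto (fun t => penalizedMoment ν s t q / penalizedMoment ν s t 0) atTop (𝓝 1) := by
  have hreal {ε : ℝ} (hε : 0 < ε) : 0 < ν.real {y | s y < ε} :=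
    ENNReal.toReal_pos (hpos ε hε).ne' (measure_ne_top _ _)
  refine tendsto_order.2 ⟨fun b hb => ?_, fun b hb => ?_⟩
  · filter_upwards [eventually_ge_atTop q] with t ht
    exact hb.trans_le ((one_le_div (penalizedMoment_pos hs hi le_rfl (hq.trans ht))).2
      (penalizedMoment_zero_le hs hi h0 hq ht))
  · obtain ⟨ε, hεb, hε⟩ : ∃ ε, Real.exp (q * ε) < b ∧ 0 < ε := by
      have hcont : ContinuousAt (fun ε : ℝ => Real.exp (q * ε)) 0 := by fun_prop
      exact (((hcont.eventually_lt_const (by simpa using hb)).filter_mono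
        nhdsWithin_le_nhds).and eventually_mem_nhdsWithin).exists (f := 𝓝[>] 0)
    obtain ⟨δ, hδ, hδε⟩ : ∃ δ > 0, ∀ x, ε ≤ s x → δ ≤ meanExcess ν s x :=
      ⟨_, mul_pos (sub_pos.2 (half_lt_self hε)) (hreal (half_pos hε)), fun _ hx =>
        mul_measureReal_lt_le_meanExcess hi (half_le_self hε.le) hx⟩
    have hlim := ((Real.tendsto_exp_neg_atTop_nhds_zero.comp <|
      tendsto_id.atTop_mul_const (sub_pos.2 (half_lt_self hδ))).const_mul
        (Real.exp (q * ∫ y, s y ∂ν + q * δ) / ν.real {y | s y < δ / 2})).const_add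
        (Real.exp (q * ε))
    filter_upwards [eventually_ge_atTop q, hlim.eventually_lt_const (by simpa using hεb)] with t ht
      htb
    exact (penalizedMoment_div_le hs hi h0 hδε (hreal (half_pos hδ)) hq ht).trans_lt htb

lemma abs_momentRatio_le_one (hs : Measurable s) (hi : Integrable s ν)
    (h0 : ∀ᵐ y ∂ν, 0 ≤ s y) (n j : ℕ) : |momentRatio ν s n j| ≤ 1 := by
  unfold momentRatio
  split_ifs with hj
  · have hjn : (2 * j : ℝ) ≤ 2 * n := by gcongr
    rw [abs_of_nonneg (Real.sqrt_nonneg _)]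
    refine Real.sqrt_le_one.2 (div_le_one_of_le₀
      (penalizedMoment_zero_le hs hi h0 (by positivity) hjn)
      (penalizedMoment_pos hs hi (by positivity) hjn).le)
  · simp

lemma tendsto_momentRatio (hs : Measurable s) (hi : Integrable s ν) (h0 : ∀ᵐ y ∂ν, 0 ≤ s y)
    (hpos : ∀ ε > 0, 0 < ν {y | s y < ε}) (j : ℕ) :
    Tendsto (fun n => momentRatio ν s n j) atTop (𝓝 1) := by
  have h2n : Tendsto (fun n : ℕ => (2 * n : ℝ)) atTop atTop :=
    tendsto_natCast_atTop_atTop.const_mul_atTop two_pos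
  have h := ((tendsto_penalizedMoment_div hs hi h0 hpos (q := 2 * j) (by positivity)).comp
    h2n).inv₀ one_ne_zero
  rw [inv_one] at h
  have h' := h.sqrt
  rw [Real.sqrt_one] at h'
  refine h'.congr' ?_
  filter_upwards [eventually_ge_atTop j] with n hn
  rw [Function.comp_apply, inv_div, momentRatio, if_pos hn]

end Concentration

section Disk

variable {r R : ℝ}

lemma mem_disk {z : ℂ} : z ∈ disk R ↔ ‖z‖ < R := Iff.rfl

lemma mem_exteriorDisk {z : ℂ} : z ∈ exteriorDisk R ↔ R < ‖z‖ := Iff.rfl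

lemma isOpen_disk (R : ℝ) : IsOpen (disk R) := isOpen_lt continuous_norm continuous_const

lemma isOpen_exteriorDisk (R : ℝ) : IsOpen (exteriorDisk R) :=
  isOpen_lt continuous_const continuous_norm

lemma disk_eq_ball (R : ℝ) : disk R = Metric.ball 0 R := by
  ext z
  simp [mem_disk]

lemma isPreconnected_disk (R : ℝ) : IsPreconnected (disk R) := by
  rw [disk_eq_ball]
  exact (convex_ball 0 R).isPreconnected

lemma isPreconnected_exteriorDisk (hR : 0 ≤ R) : IsPreconnected (exteriorDisk R) := by
  have himage : (fun p : ℝ × ℝ => (p.1 : ℂ) * Complex.exp (p.2 * Complex.I)) ''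
      (Set.Ioi R ×ˢ Set.univ) = exteriorDisk R := by
    ext z
    constructor
    · rintro ⟨⟨t, θ⟩, ⟨ht : R < t, -⟩, rfl⟩
      simpa [exteriorDisk, Complex.norm_exp_ofReal_mul_I, abs_of_pos (hR.trans_lt ht)] using ht
    · exact fun hz => ⟨(‖z‖, z.arg), ⟨hz, trivial⟩, Complex.norm_mul_exp_arg_mul_I z⟩
  rw [← himage]
  exact (isPreconnected_Ioi.prod isPreconnected_univ).image _ (by fun_prop)

lemma disk_ssubset_disk (hr : 0 ≤ r) (h : r < R) : disk r ⊂ disk R := by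
  have hsub : disk r ⊆ disk R := fun z hz => lt_trans hz h
  refine (Set.ssubset_iff_of_subset hsub).2 ⟨r, ?_⟩
  simpa [mem_disk, abs_of_nonneg hr] using h

lemma exteriorDisk_ssubset_exteriorDisk (hR : 0 ≤ R) (h : r < R) :
    exteriorDisk R ⊂ exteriorDisk r := by
  have hsub : exteriorDisk R ⊆ exteriorDisk r := fun z hz => lt_trans h hz
  refine (Set.ssubset_iff_of_subset hsub).2 ⟨R, ?_⟩
  simpa [mem_exteriorDisk, abs_of_nonneg hR] using h

end Disk

section PowerSeries

open FormalMultilinearSeries (ofScalars)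

variable {a b : ℕ → ℂ} {z : ℂ}

lemma disk_one_subset_eball_radius (ha : 1 ≤ (ofScalars ℂ a).radius) :
    disk 1 ⊆ Metric.eball 0 (ofScalars ℂ a).radius := by
  rw [disk_eq_ball, ← Metric.eball_ofReal, ENNReal.ofReal_one]
  exact Metric.eball_subset_eball ha

lemma summable_mul_pow (hz : z ∈ Metric.eball 0 (ofScalars ℂ a).radius) :
    Summable fun k => a k * z ^ k := by
  simpa [mul_comm] using (ofScalars ℂ a).summable hz

lemma coeffSeries_eq_sum_ofScalars (a : ℕ → ℂ) : coeffSeries a = (ofScalars ℂ a).sum := by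
  ext z
  simp [coeffSeries, FormalMultilinearSeries.sum, mul_comm]

lemma analyticOnNhd_coeffSeries (a : ℕ → ℂ) :
    AnalyticOnNhd ℂ (coeffSeries a) (Metric.eball 0 (ofScalars ℂ a).radius) := by
  intro z hz
  rw [coeffSeries_eq_sum_ofScalars]
  exact ((ofScalars ℂ a).hasFPowerSeriesOnBall (pos_of_gt hz)).analyticOnNhd z hz

lemma analyticOrderAt_coeffSeries_ne_top (ha : a ≠ 0)
    (hz : z ∈ Metric.eball 0 (ofScalars ℂ a).radius) :
    analyticOrderAt (coeffSeries a) z ≠ ⊤ := by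
  have hpos : 0 < (ofScalars ℂ a).radius := pos_of_gt hz
  have hpre : IsPreconnected (Metric.eball (0 : ℂ) (ofScalars ℂ a).radius) :=
    (convex_eball ..).isPreconnected
  refine (analyticOnNhd_coeffSeries a).analyticOrderAt_ne_top_of_isPreconnected hpre
    (Metric.mem_eball_self hpos) hz fun htop => ha ?_
  rw [analyticOrderAt_eq_top, coeffSeries_eq_sum_ofScalars] at htop
  exact (FormalMultilinearSeries.ofScalars_series_eq_zero ℂ).1
    (((ofScalars ℂ a).hasFPowerSeriesOnBall hpos).hasFPowerSeriesAt.eq_zero_of_eventually htop)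

lemma radius_ofScalars_eq_top_of_finite_support (ha : (Function.support a).Finite) :
    (ofScalars ℂ a).radius = ⊤ := by
  refine (ofScalars ℂ a).radius_eq_top_of_eventually_eq_zero ?_
  filter_upwards [Nat.cofinite_eq_atTop ▸ ha.eventually_cofinite_notMem] with k hk
  simpa using hk

variable {ι : Type*} {l : Filter ι} {A : ι → ℕ → ℂ}

lemma tendsto_coeffSeries (hle : ∀ᶠ i in l, ∀ k, ‖A i k‖ ≤ ‖b k‖)
    (hA : ∀ k, Tendsto (fun i => A i k) l (𝓝 (a k))) {w : ι → ℂ} (hw : Tendsto w l (𝓝 z))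
    (hz : z ∈ Metric.eball 0 (ofScalars ℂ b).radius) :
    Tendsto (fun i => coeffSeries (A i) (w i)) l (𝓝 (coeffSeries a z)) := by
  obtain ⟨ρ, hzρ, hρ⟩ := ENNReal.lt_iff_exists_nnreal_btwn.1 (mem_eball_zero_iff.1 hz)
  have hwρ : ∀ᶠ i in l, ‖w i‖ < ρ :=
    hw.norm.eventually_lt_const (by simpa [enorm_eq_nnnorm, ← NNReal.coe_lt_coe] using hzρ)
  refine tendsto_tsum_of_dominated_convergence
    (by simpa using (ofScalars ℂ b).summable_norm_mul_pow hρ)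
    (fun k => (hA k).mul (hw.pow k)) ?_
  filter_upwards [hle, hwρ] with i hi hwi k
  rw [norm_mul, norm_pow]
  gcongr
  exact hi k

lemma tendstoLocallyUniformlyOn_coeffSeries (hle : ∀ᶠ i in l, ∀ k, ‖A i k‖ ≤ ‖b k‖)
    (hA : ∀ k, Tendsto (fun i => A i k) l (𝓝 (a k))) :
    TendstoLocallyUniformlyOn (fun i => coeffSeries (A i)) (coeffSeries a) l
      (Metric.eball 0 (ofScalars ℂ b).radius) := by
  rw [tendstoLocallyUniformlyOn_iff_forall_tendsto]
  intro z hz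
  rcases l.eq_or_neBot with rfl | _
  · simp
  have hab (k : ℕ) : ‖a k‖ ≤ ‖b k‖ := le_of_tendsto (hA k).norm (hle.mono fun i hi => hi k)
  have hw : Tendsto Prod.snd (l ×ˢ 𝓝[Metric.eball 0 (ofScalars ℂ b).radius] z) (𝓝 z) :=
    tendsto_snd.mono_right nhdsWithin_le_nhds
  refine (Tendsto.prodMk_nhds ?_ ?_).mono_right (nhds_le_uniformity (coeffSeries a z))
  · exact tendsto_coeffSeries (.of_forall fun _ => hab) (fun k => tendsto_const_nhds) hw hz
  · exact tendsto_coeffSeries (tendsto_fst.eventually hle) (fun k => (hA k).comp tendsto_fst) hw hz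

lemma tendsto_zerosIn_coeffSeries [l.NeBot] [l.IsCountablyGenerated]
    (hle : ∀ᶠ i in l, ∀ k, ‖A i k‖ ≤ ‖b k‖) (hA : ∀ k, Tendsto (fun i => A i k) l (𝓝 (a k)))
    (ha : a ≠ 0) {U : Set ℂ} (hU : IsOpen U) {ψ : ℂ → ℂ} (hψ : AnalyticOnNhd ℂ ψ U)
    (hψ' : ∀ z ∈ U, deriv ψ z ≠ 0)
    (hmaps : Set.MapsTo ψ U (Metric.eball 0 (ofScalars ℂ b).radius)) :
    Tendsto (fun i => zerosIn U fun z => coeffSeries (A i) (ψ z)) l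
      (𝓝 (zerosIn U fun z => coeffSeries a (ψ z))) := by
  have hmaps' {a' : ℕ → ℂ} (h : ∀ k, ‖a' k‖ ≤ ‖b k‖) :
      Set.MapsTo ψ U (Metric.eball 0 (ofScalars ℂ a').radius) :=
    hmaps.mono_right (Metric.eball_subset_eball
      (FormalMultilinearSeries.radius_le_of_le fun k => by simpa using h k))
  have hab (k : ℕ) : ‖a k‖ ≤ ‖b k‖ := le_of_tendsto (hA k).norm (hle.mono fun i hi => hi k)
  refine tendsto_zerosIn hU
    (hle.mono fun i hi => (analyticOnNhd_coeffSeries (A i)).comp hψ (hmaps' hi))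
    ((analyticOnNhd_coeffSeries a).comp hψ (hmaps' hab))
    ((tendstoLocallyUniformlyOn_coeffSeries hle hA).comp ψ hmaps hψ.continuousOn) fun x hx => ?_
  have hord := analyticOrderAt_comp_of_deriv_ne_zero (f := coeffSeries a) (hψ x hx) (hψ' x hx)
  exact hord ▸ analyticOrderAt_coeffSeries_ne_top ha (hmaps' hab hx)

lemma measurable_zerosIn_coeffSeries {c : ℕ → ℂ} (hc : (Function.support c).Finite) {U : Set ℂ}
    (hU : IsOpen U) {ψ : ℂ → ℂ} (hψ : AnalyticOnNhd ℂ ψ U) (hψ' : ∀ z ∈ U, deriv ψ z ≠ 0) :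
    Measurable fun a => zerosIn U fun z => coeffSeries (c * a) (ψ z) := by
  classical
  let Z : (ℕ → ℂ) → PointConfig U := fun a => zerosIn U fun z => coeffSeries (c * a) (ψ z)
  have hopen : IsOpen {a | c * a ≠ 0} := isOpen_ne_fun (by fun_prop) continuous_const
  have hcont : ContinuousOn Z {a | c * a ≠ 0} := by
    intro a ha
    let b : ℕ → ℂ := fun k => c k * (‖a k‖ + 1 : ℝ)
    have hb : (ofScalars ℂ b).radius = ⊤ := radius_ofScalars_eq_top_of_finite_support
      (hc.subset (Function.support_mul_subset_left c _))
    refine (tendsto_zerosIn_coeffSeries (b := b) ?_ (fun k => ?_) ha hU hψ hψ' ?_).mono_left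
      nhdsWithin_le_nhds
    · have hnear : ∀ᶠ a' in 𝓝 a, ∀ k ∈ Function.support c, ‖a' k‖ < ‖a k‖ + 1 :=
        (eventually_all_finite hc).2 fun k _ =>
          (continuous_apply k).norm.tendsto a |>.eventually_lt_const (lt_add_one _)
      filter_upwards [hnear] with a' ha' k
      by_cases hk : c k = 0
      · simp [b, hk]
      · rw [Pi.mul_apply, norm_mul, norm_mul, Complex.norm_real,
          Real.norm_of_nonneg (by positivity)]
        gcongr
        exact (ha' k hk).le
    · exact Continuous.tendsto (by fun_prop : Continuous fun a' : ℕ → ℂ => c k * a' k) a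
    · simp [hb]
  have hconst : ContinuousOn Z {a | c * a ≠ 0}ᶜ := by
    refine (continuousOn_const (c := zerosIn U fun z => coeffSeries 0 (ψ z))).congr fun a ha => ?_
    simp only [Z, not_not.1 ha]
  simpa using hcont.measurable_piecewise hconst hopen.measurableSet

end PowerSeries

section RandomSeries

open FormalMultilinearSeries (ofScalars)

variable {Ω : Type*} [MeasurableSpace Ω] {μ : Measure Ω} {a : ℕ → Ω → ℂ}

/-- The law of the sequence is invariant under permutations of `ℕ`. All permutations are allowed,
which amounts to allowing those that move finitely many indices. -/
def IsExchangeable (μ : Measure Ω) (a : ℕ → Ω → ℂ) : Prop :=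
  ∀ σ : Equiv.Perm ℕ, IdentDistrib (fun ω k => a (σ k) ω) (fun ω k => a k ω) μ μ

lemma IsExchangeable.identDistrib (ha : IsExchangeable μ a) (k : ℕ) :
    IdentDistrib (a k) (a 0) μ μ := by
  simpa [Function.comp_def] using (ha (.swap 0 k)).comp (measurable_pi_apply 0)

lemma IsCoefficientSequence.isExchangeable (ha : IsCoefficientSequence μ a) :
    IsExchangeable μ a := by
  intro σ
  refine ⟨(measurable_pi_iff.2 fun k => ha.measurable _).aemeasurable,
    (measurable_pi_iff.2 ha.measurable).aemeasurable, ?_⟩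
  rw [(ha.indep.precomp σ.injective).map_fun_eq_infinitePi_map fun k => ha.measurable _,
    ha.indep.map_fun_eq_infinitePi_map ha.measurable]
  congr 1 with k : 1
  rw [(ha.identDistrib (σ k)).map_eq, (ha.identDistrib k).map_eq]

/-- The involution of `ℕ` that reverses `{0, …, n}` and fixes the larger numbers. -/
def reverseUpTo (n : ℕ) : Equiv.Perm ℕ :=
  Function.Involutive.toPerm (fun k => if k ≤ n then n - k else k) fun k => by grind

lemma reverseUpTo_of_le {n k : ℕ} (hk : k ≤ n) : reverseUpTo n k = n - k := if_pos hk

variable [IsProbabilityMeasure μ]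

lemma ae_eventually_norm_le_exp (hid : ∀ k, IdentDistrib (a k) (a 0) μ μ)
    (hlog : Integrable (fun ω => Real.log (1 + ‖a 0 ω‖)) μ) {ε : ℝ} (hε : 0 < ε) :
    ∀ᵐ ω ∂μ, ∀ᶠ k : ℕ in atTop, ‖a k ω‖ ≤ Real.exp (ε * k) := by
  let t : ℕ → Set ℂ := fun k => {z | (k : ℝ) < ε⁻¹ * Real.log (1 + ‖z‖)}
  have ht (k : ℕ) : MeasurableSet (t k) :=
    measurableSet_lt measurable_const (by fun_prop)
  have hsum : ∑' k, μ {ω | a 0 ω ∈ t k} < ⊤ :=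
    letI : MeasureSpace Ω := ⟨μ⟩
    tsum_prob_mem_Ioi_lt_top (hlog.const_mul ε⁻¹) fun ω =>
      mul_nonneg (by positivity) (Real.log_nonneg (by linarith [norm_nonneg (a 0 ω)]))
  have heq (k : ℕ) : μ {ω | a k ω ∈ t k} = μ {ω | a 0 ω ∈ t k} := (hid k).measure_mem_eq (ht k)
  have hBC : ∀ᵐ ω ∂μ, ∀ᶠ k in atTop, ω ∉ {ω | a k ω ∈ t k} :=
    ae_eventually_notMem (by simpa only [heq] using hsum.ne)
  filter_upwards [hBC] with ω hω
  filter_upwards [hω] with k hk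
  have hk : Real.log (1 + ‖a k ω‖) ≤ ε * k := (inv_mul_le_iff₀ hε).1 (not_lt.1 hk)
  linarith [(Real.log_le_iff_le_exp (by positivity)).1 hk]

lemma ae_one_le_radius_ofScalars (hid : ∀ k, IdentDistrib (a k) (a 0) μ μ)
    (hlog : Integrable (fun ω => Real.log (1 + ‖a 0 ω‖)) μ) :
    ∀ᵐ ω ∂μ, 1 ≤ (ofScalars ℂ fun k => a k ω).radius := by
  filter_upwards [ae_all_iff.2 fun m : ℕ =>
    ae_eventually_norm_le_exp hid hlog (Nat.one_div_pos_of_nat (α := ℝ) (n := m))] with ω hω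
  have hlim : Tendsto (fun m : ℕ => ENNReal.ofReal (Real.exp (-(1 / ((m : ℝ) + 1))))) atTop
      (𝓝 1) := by
    have hcont : Continuous fun x => ENNReal.ofReal (Real.exp (-x)) :=
      ENNReal.continuous_ofReal.comp (by fun_prop)
    simpa [Function.comp_def] using (hcont.tendsto 0).comp tendsto_one_div_add_atTop_nhds_zero_nat
  refine le_of_tendsto' hlim fun m => ?_
  refine FormalMultilinearSeries.le_radius_of_eventually_le _ 1 ((hω m).mono fun k hk => ?_)
  rw [FormalMultilinearSeries.ofScalars_norm, Real.coe_toNNReal _ (Real.exp_pos _).le,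
    ← Real.exp_nat_mul]
  calc ‖a k ω‖ * Real.exp (k * -(1 / (m + 1)))
      ≤ Real.exp (1 / (m + 1) * k) * Real.exp (k * -(1 / (m + 1))) := by gcongr
    _ = 1 := by
        rw [← Real.exp_add, ← Real.exp_zero]
        congr 1
        ring

lemma tendstoInDistribution_zerosIn_coeffSeries {A : Ω → ℕ → ℂ} {B : ℕ → Ω → ℕ → ℂ}
    (hB : ∀ n, IdentDistrib (B n) A μ μ) (hA : ∀ᵐ ω ∂μ, A ω ≠ 0)
    (hrad : ∀ᵐ ω ∂μ, 1 ≤ (ofScalars ℂ (A ω)).radius) {c : ℕ → ℕ → ℂ}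
    (hc : ∀ n, (Function.support (c n)).Finite) (hc1 : ∀ n k, ‖c n k‖ ≤ 1)
    (hlim : ∀ k, Tendsto (fun n => c n k) atTop (𝓝 1)) {U : Set ℂ} (hU : IsOpen U) {ψ : ℂ → ℂ}
    (hψ : AnalyticOnNhd ℂ ψ U) (hψ' : ∀ z ∈ U, deriv ψ z ≠ 0) (hmaps : Set.MapsTo ψ U (disk 1)) :
    TendstoInDistribution (fun n ω => zerosIn U fun z => coeffSeries (c n * B n ω) (ψ z)) atTop
      (fun ω => zerosIn U fun z => coeffSeries (A ω) (ψ z)) (fun _ => μ) μ := by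
  have hmeas (n : ℕ) := measurable_zerosIn_coeffSeries (hc n) hU hψ hψ'
  have : LocallyCompactSpace U := hU.locallyCompactSpace
  have hconv : ∀ᵐ ω ∂μ, Tendsto (fun n => zerosIn U fun z => coeffSeries (c n * A ω) (ψ z)) atTop
      (𝓝 (zerosIn U fun z => coeffSeries (A ω) (ψ z))) := by
    filter_upwards [hA, hrad] with ω hω hω1
    refine tendsto_zerosIn_coeffSeries (b := A ω) (.of_forall fun n k => ?_) (fun k => ?_) hω hU hψ
      hψ' (hmaps.mono_right (disk_one_subset_eball_radius hω1))
    · simpa using mul_le_of_le_one_left (norm_nonneg _) (hc1 n k)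
    · simpa using (hlim k).mul_const (A ω k)
  have hident (n : ℕ) := (hB n).comp (hmeas n)
  have hdist := tendstoInDistribution_of_ae_tendsto (fun n => (hident n).aemeasurable_snd)
    (aemeasurable_of_tendsto_metrizable_ae atTop (fun n => (hident n).aemeasurable_snd) hconv) hconv
  exact ⟨fun n => (hident n).aemeasurable_fst, hdist.aemeasurable_limit,
    hdist.tendsto.congr fun n => Subtype.ext (hident n).map_eq.symm⟩

end RandomSeries

section Component

variable {ν : Measure ℂ} {U : Set ℂ} {R ε : ℝ}

lemma IsComponentOf.measure_eq_zero (h : IsComponentOf U ν.supportᶜ) : ν U = 0 := by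
  obtain ⟨x, -, rfl⟩ := h
  exact measure_mono_null (connectedComponentIn_subset _ _) Measure.support_mem_ae

lemma IsComponentOf.measure_pos_of_ssubset (h : IsComponentOf U ν.supportᶜ) {V : Set ℂ}
    (hV : IsOpen V) (hVc : IsPreconnected V) (hUV : U ⊂ V) : 0 < ν V := by
  obtain ⟨x, hx, rfl⟩ := h
  refine pos_iff_ne_zero.2 fun h0 => hUV.not_subset ?_
  exact hVc.subset_connectedComponentIn (hUV.subset (mem_connectedComponentIn hx))
    (Measure.subset_compl_support_of_isOpen hV h0)

/-- The logarithmic distance to the circle of radius `R`, counted positively outside. -/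
noncomputable def logOutward (R : ℝ) (z : ℂ) : ℝ := Real.log ‖z‖ - Real.log R

/-- The logarithmic distance to the circle of radius `R`, counted positively inside. -/
noncomputable def logInward (R : ℝ) (z : ℂ) : ℝ := Real.log R - Real.log ‖z‖

lemma logOutward_lt_iff (hR : 0 < R) {z : ℂ} (hz : z ≠ 0) :
    logOutward R z < ε ↔ z ∈ disk (R * Real.exp ε) := by
  rw [logOutward, ← Real.log_div (norm_ne_zero_iff.2 hz) hR.ne',
    Real.log_lt_iff_lt_exp (div_pos (norm_pos_iff.2 hz) hR), div_lt_iff₀' hR,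
    mem_disk]

lemma logInward_lt_iff (hR : 0 < R) {z : ℂ} (hz : z ≠ 0) :
    logInward R z < ε ↔ z ∈ exteriorDisk (R * Real.exp (-ε)) := by
  rw [logInward, ← Real.log_div hR.ne' (norm_ne_zero_iff.2 hz),
    Real.log_lt_iff_lt_exp (div_pos hR (norm_pos_iff.2 hz)), div_lt_iff₀ (norm_pos_iff.2 hz),
    Real.exp_neg, ← div_eq_mul_inv, ← div_lt_iff₀' (Real.exp_pos ε),
    mem_exteriorDisk]

lemma measurable_logOutward (R : ℝ) : Measurable (logOutward R) :=
  (Real.measurable_log.comp measurable_norm).sub_const _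

lemma measurable_logInward (R : ℝ) : Measurable (logInward R) :=
  (Real.measurable_log.comp measurable_norm).const_sub _

namespace IsBackground

variable (hν : IsBackground ν)
include hν

lemma ae_logOutward_nonneg (hR : 0 < R) (h : IsComponentOf (disk R) ν.supportᶜ) :
    ∀ᵐ z ∂ν, 0 ≤ logOutward R z := by
  filter_upwards [measure_eq_zero_iff_ae_notMem.1 h.measure_eq_zero, hν.ae_ne_zero] with z hz hz0
  exact not_lt.1 fun hlt => hz (by simpa using (logOutward_lt_iff hR hz0).1 hlt)

lemma ae_logInward_nonneg (hR : 0 < R) (h : IsComponentOf (exteriorDisk R) ν.supportᶜ) :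
    ∀ᵐ z ∂ν, 0 ≤ logInward R z := by
  filter_upwards [measure_eq_zero_iff_ae_notMem.1 h.measure_eq_zero, hν.ae_ne_zero] with z hz hz0
  exact not_lt.1 fun hlt => hz (by simpa using (logInward_lt_iff hR hz0).1 hlt)

lemma measure_logOutward_lt_pos (hR : 0 < R) (h : IsComponentOf (disk R) ν.supportᶜ)
    (hε : 0 < ε) : 0 < ν {z | logOutward R z < ε} := by
  have hlt : R < R * Real.exp ε := lt_mul_of_one_lt_right hR (Real.one_lt_exp_iff.2 hε)
  calc 0 < ν (disk (R * Real.exp ε)) := h.measure_pos_of_ssubset (isOpen_disk _)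
        (isPreconnected_disk _) (disk_ssubset_disk hR.le hlt)
    _ ≤ _ := measure_mono_ae (hν.ae_ne_zero.mono fun z hz => (logOutward_lt_iff hR hz).2)

lemma measure_logInward_lt_pos (hR : 0 < R) (h : IsComponentOf (exteriorDisk R) ν.supportᶜ)
    (hε : 0 < ε) : 0 < ν {z | logInward R z < ε} := by
  have hlt : R * Real.exp (-ε) < R :=
    mul_lt_of_lt_one_right hR (Real.exp_lt_one_iff.2 (neg_lt_zero.2 hε))
  calc 0 < ν (exteriorDisk (R * Real.exp (-ε))) := h.measure_pos_of_ssubset (isOpen_exteriorDisk _)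
        (isPreconnected_exteriorDisk (by positivity)) (exteriorDisk_ssubset_exteriorDisk hR.le hlt)
    _ ≤ _ := measure_mono_ae (hν.ae_ne_zero.mono fun z hz => (logInward_lt_iff hR hz).2)

end IsBackground

end Component

section WeightedPoly

variable {ν : Measure ℂ} [IsProbabilityMeasure ν] {R : ℝ}

lemma posLog_inv_mul_norm {z w : ℂ} (hz : z ≠ 0) (hw : w ≠ 0) :
    Real.posLog (‖z‖⁻¹ * ‖w‖) = max 0 (Real.log ‖w‖ - Real.log ‖z‖) := by
  rw [Real.posLog_apply, Real.log_mul (inv_ne_zero (norm_ne_zero_iff.2 hz))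
    (norm_ne_zero_iff.2 hw), Real.log_inv, neg_add_eq_sub]

lemma sqrt_integral_sq_mul {X : Type*} [MeasurableSpace X] (ρ : Measure X) {c : ℝ} (hc : 0 ≤ c)
    (f : X → ℝ) : √(∫ x, c ^ 2 * f x ∂ρ) = c * √(∫ x, f x ∂ρ) := by
  rw [integral_const_mul, Real.sqrt_mul (sq_nonneg c), Real.sqrt_sq hc]

lemma norm_pow_sq_eq_exp {z : ℂ} (hz : z ≠ 0) (k : ℕ) :
    ‖z ^ k‖ ^ 2 = Real.exp (2 * k * Real.log ‖z‖) := by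
  rw [norm_pow, ← pow_mul', ← Real.exp_log (norm_pos_iff.2 hz), ← Real.exp_nat_mul, Real.log_exp]
  push_cast
  rfl

namespace IsBackground

variable (hν : IsBackground ν)
include hν

lemma integrable_logOutward (R : ℝ) : Integrable (logOutward R) ν :=
  hν.integrable_log.sub (integrable_const _)

lemma integrable_logInward (R : ℝ) : Integrable (logInward R) ν :=
  (integrable_const _).sub hν.integrable_log

lemma logPotential_eq_add_meanExcess_logOutward (R : ℝ) {z : ℂ} (hz : z ≠ 0) :
    logPotential ν z = (∫ w, Real.log ‖w‖ ∂ν) + meanExcess ν (logOutward R) z := by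
  rw [hν.logPotential_eq_integral_posLog hz, meanExcess,
    ← integral_add hν.integrable_log (integrable_max_sub (hν.integrable_logOutward R) z)]
  refine integral_congr_ae (hν.ae_ne_zero.mono fun w hw => ?_)
  simp only [posLog_inv_mul_norm hz hw, logOutward, sub_sub_sub_cancel_right]
  grind

lemma logPotential_eq_add_meanExcess_logInward (R : ℝ) {z : ℂ} (hz : z ≠ 0) :
    logPotential ν z = Real.log ‖z‖ + meanExcess ν (logInward R) z := by
  calc logPotential ν z = ∫ w, (Real.log ‖z‖ + max (logInward R z - logInward R w) 0) ∂ν := by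
        rw [hν.logPotential_eq_integral_posLog hz]
        refine integral_congr_ae (hν.ae_ne_zero.mono fun w hw => ?_)
        simp only [posLog_inv_mul_norm hz hw, logInward, sub_sub_sub_cancel_left, max_comm]
    _ = Real.log ‖z‖ + meanExcess ν (logInward R) z := by
        rw [integral_add (integrable_const _) (integrable_max_sub (hν.integrable_logInward R) z),
          integral_const, probReal_univ, one_smul, meanExcess]

lemma monomialNorm_eq_mul_sqrt_penalizedMoment_logOutward (hR : 0 < R) (n k : ℕ) :
    monomialNorm ν n k = R ^ k * Real.exp (-(n * ∫ w, Real.log ‖w‖ ∂ν))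
      * √(penalizedMoment ν (logOutward R) (2 * n) (2 * k)) := by
  rw [monomialNorm, penalizedMoment, ← sqrt_integral_sq_mul ν (by positivity)]
  congr 1
  refine integral_congr_ae (hν.ae_ne_zero.mono fun z hz => ?_)
  simp only
  have hRk : R ^ k = Real.exp (k * Real.log R) := by rw [Real.exp_nat_mul, Real.exp_log hR]
  rw [norm_pow_sq_eq_exp hz, hν.logPotential_eq_add_meanExcess_logOutward R hz, hRk,
    penalizedWeight, ← Real.exp_add, ← Real.exp_add, ← Real.exp_nat_mul, ← Real.exp_add,
    logOutward]
  congr 1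
  push_cast
  ring

lemma monomialNorm_sub_eq_mul_sqrt_penalizedMoment_logInward (hR : 0 < R) {n j : ℕ}
    (hj : j ≤ n) : monomialNorm ν n (n - j)
      = (R ^ j)⁻¹ * √(penalizedMoment ν (logInward R) (2 * n) (2 * j)) := by
  rw [monomialNorm, penalizedMoment, ← sqrt_integral_sq_mul ν (by positivity)]
  congr 1
  refine integral_congr_ae (hν.ae_ne_zero.mono fun z hz => ?_)
  simp only
  have hRj : (R ^ j)⁻¹ = Real.exp (-(j * Real.log R)) := by
    rw [Real.exp_neg, Real.exp_nat_mul, Real.exp_log hR]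
  rw [norm_pow_sq_eq_exp hz, hν.logPotential_eq_add_meanExcess_logInward R hz, hRj,
    penalizedWeight, ← Real.exp_add, ← Real.exp_nat_mul, ← Real.exp_add, logInward,
    Nat.cast_sub hj]
  congr 1
  push_cast
  ring

lemma monomialNorm_pos {n k : ℕ} (hk : k ≤ n) : 0 < monomialNorm ν n k := by
  rw [hν.monomialNorm_eq_mul_sqrt_penalizedMoment_logOutward one_pos]
  have := penalizedMoment_pos (measurable_logOutward 1) (hν.integrable_logOutward 1)
    (q := 2 * k) (t := 2 * n) (by positivity) (by gcongr)
  positivity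

lemma momentRatio_logOutward (hR : 0 < R) {n k : ℕ} (hk : k ≤ n) :
    momentRatio ν (logOutward R) n k = R ^ k * (monomialNorm ν n 0 / monomialNorm ν n k) := by
  have hnorm := hν.monomialNorm_eq_mul_sqrt_penalizedMoment_logOutward hR n
  have hk0 := (hν.monomialNorm_pos hk).ne'
  have h0 := hnorm 0
  rw [hnorm k] at hk0 ⊢
  rw [h0, momentRatio, if_pos hk, Real.sqrt_div' _ penalizedMoment_nonneg]
  simp only [Nat.cast_zero, mul_zero]
  field_simp

lemma momentRatio_logInward (hR : 0 < R) {n j : ℕ} (hj : j ≤ n) :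
    momentRatio ν (logInward R) n j
      = monomialNorm ν n n / (R ^ j * monomialNorm ν n (n - j)) := by
  have h0 := hν.monomialNorm_sub_eq_mul_sqrt_penalizedMoment_logInward hR (Nat.zero_le n)
  rw [hν.monomialNorm_sub_eq_mul_sqrt_penalizedMoment_logInward hR hj]
  simp only [tsub_zero, Nat.cast_zero, mul_zero, pow_zero, inv_one, one_mul] at h0
  rw [h0, momentRatio, if_pos hj, Real.sqrt_div' _ penalizedMoment_nonneg,
    mul_inv_cancel_left₀ (pow_ne_zero j hR.ne')]

end IsBackground

lemma coeffSeries_mul_eq_sum {c : ℕ → ℂ} {n : ℕ} (hc : Function.support c ⊆ Set.Iic n)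
    (a : ℕ → ℂ) (z : ℂ) :
    coeffSeries (c * a) z = ∑ k ∈ Finset.range (n + 1), c k * a k * z ^ k := by
  refine tsum_eq_sum fun k hk => ?_
  have hck : c k = 0 := Function.notMem_support.1 fun h => hk (Finset.mem_range_succ_iff.2 (hc h))
  simp [hck]

lemma IsBackground.weightedPoly_eq_mul_coeffSeries_div (hν : IsBackground ν) (hR : 0 < R) (n : ℕ)
    (a : ℕ → ℂ) (z : ℂ) :
    weightedPoly ν n a z = (monomialNorm ν n 0 : ℂ)⁻¹
      * coeffSeries ((fun k => (momentRatio ν (logOutward R) n k : ℂ)) * a) (z / R) := by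
  rw [coeffSeries_mul_eq_sum (support_ofReal_momentRatio_subset n), weightedPoly,
    Finset.mul_sum]
  refine Finset.sum_congr rfl fun k hk => ?_
  rw [hν.momentRatio_logOutward hR (Finset.mem_range_succ_iff.1 hk)]
  have hRC : (R : ℂ) ≠ 0 := Complex.ofReal_ne_zero.2 hR.ne'
  have h0 : (monomialNorm ν n 0 : ℂ) ≠ 0 :=
    Complex.ofReal_ne_zero.2 (hν.monomialNorm_pos n.zero_le).ne'
  rw [div_pow]
  push_cast
  field_simp

lemma IsBackground.weightedPoly_eq_mul_coeffSeries_const_div (hν : IsBackground ν) (hR : 0 < R)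
    (n : ℕ) (a : ℕ → ℂ) {z : ℂ} (hz : z ≠ 0) :
    weightedPoly ν n a z = z ^ n / monomialNorm ν n n
      * coeffSeries ((fun k => (momentRatio ν (logInward R) n k : ℂ))
        * fun k => a (reverseUpTo n k)) (R / z) := by
  rw [coeffSeries_mul_eq_sum (support_ofReal_momentRatio_subset n), weightedPoly,
    Finset.mul_sum, ← Finset.sum_flip]
  refine Finset.sum_congr rfl fun j hj => ?_
  have hjn := Finset.mem_range_succ_iff.1 hj
  rw [hν.momentRatio_logInward hR hjn, reverseUpTo_of_le hjn, pow_sub₀ z hz hjn, div_pow]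
  have hRC : (R : ℂ) ≠ 0 := Complex.ofReal_ne_zero.2 hR.ne'
  have hn : (monomialNorm ν n n : ℂ) ≠ 0 :=
    Complex.ofReal_ne_zero.2 (hν.monomialNorm_pos le_rfl).ne'
  push_cast
  field_simp

end WeightedPoly

section Zeros

variable {U : Set ℂ}

lemma zerosIn_eq_of_eqOn_mul (hU : IsOpen U) {f g h : ℂ → ℂ} (hf : AnalyticOnNhd ℂ f U)
    (hh : AnalyticOnNhd ℂ h U) (hne : ∀ z ∈ U, h z ≠ 0) (heq : Set.EqOn f (h * g) U) :
    zerosIn U f = zerosIn U g := by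
  have hg : AnalyticOnNhd ℂ g U := (hf.div hh hne).congr hU fun z hz => by
    simp only [heq hz, Pi.mul_apply, mul_div_cancel_left₀ _ (hne z hz)]
  ext x
  rw [zerosIn_mult hf, zerosIn_mult hg, analyticOrderNatAt, analyticOrderNatAt,
    analyticOrderAt_congr (heq.eventuallyEq_of_mem (hU.mem_nhds x.2)),
    analyticOrderAt_mul (hh x x.2) (hg x x.2),
    (hh x x.2).analyticOrderAt_eq_zero.2 (hne x x.2), zero_add]

lemma map_zerosIn_dilation {V : Set ℂ} (e : U ≃ₜ V) {c : ℂ} (hc : c ≠ 0)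
    (he : ∀ x, (e x : ℂ) = c * x) {f : ℂ → ℂ} (hf : AnalyticOnNhd ℂ f U) :
    (zerosIn U f).map e = zerosIn V fun z => f (z / c) := by
  have hcancel (x : U) : (e x : ℂ) / c = x := by rw [he, mul_div_cancel_left₀ _ hc]
  have hmaps : Set.MapsTo (fun z => z / c) V U := fun y hy => by
    obtain ⟨x, hx⟩ := e.surjective ⟨y, hy⟩
    have hxy : y / c = x := by rw [← hcancel x, hx]
    simpa only [hxy] using x.2
  have hdiv : AnalyticOnNhd ℂ (fun z : ℂ => z / c) V := fun z _ => by fun_prop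
  ext y
  obtain ⟨x, rfl⟩ := e.surjective y
  have hderiv : deriv (fun z : ℂ => z / c) (e x) ≠ 0 := by simp [hc]
  have hcomp := analyticOrderAt_comp_of_deriv_ne_zero (f := f) (hdiv _ (e x).2) hderiv
  rw [hcancel] at hcomp
  calc ((zerosIn U f).map e).mult (e x) = (zerosIn U f).mult x :=
        congrArg (zerosIn U f).mult (e.symm_apply_apply x)
    _ = (zerosIn V fun z => f (z / c)).mult (e x) := by
        rw [zerosIn_mult hf, analyticOrderNatAt, ← hcomp]
        exact (zerosIn_mult (hf.comp hdiv hmaps) (e x)).symm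

variable {ν : Measure ℂ} {R : ℝ}

lemma analyticOnNhd_weightedPoly (n : ℕ) (a : ℕ → ℂ) :
    AnalyticOnNhd ℂ (weightedPoly ν n a) U := fun z _ => by
  unfold weightedPoly
  fun_prop

variable [IsProbabilityMeasure ν]

lemma zerosIn_weightedPoly_eq_div (hν : IsBackground ν) (hR : 0 < R) (hU : IsOpen U) (n : ℕ)
    (a : ℕ → ℂ) : zerosIn U (weightedPoly ν n a) = zerosIn U fun z =>
      coeffSeries ((fun k => (momentRatio ν (logOutward R) n k : ℂ)) * a) (z / R) := by
  have hnorm : (monomialNorm ν n 0 : ℂ) ≠ 0 :=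
    Complex.ofReal_ne_zero.2 (hν.monomialNorm_pos n.zero_le).ne'
  exact zerosIn_eq_of_eqOn_mul hU (analyticOnNhd_weightedPoly n a) analyticOnNhd_const
    (fun _ _ => inv_ne_zero hnorm) fun z _ => hν.weightedPoly_eq_mul_coeffSeries_div hR n a z

lemma zerosIn_weightedPoly_eq_const_div (hν : IsBackground ν) (hR : 0 < R) (hU : IsOpen U)
    (hU0 : 0 ∉ U) (n : ℕ) (a : ℕ → ℂ) : zerosIn U (weightedPoly ν n a) = zerosIn U fun z =>
      coeffSeries ((fun k => (momentRatio ν (logInward R) n k : ℂ))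
        * fun k => a (reverseUpTo n k)) (R / z) := by
  have hne {z : ℂ} (hz : z ∈ U) : z ≠ 0 := ne_of_mem_of_not_mem hz hU0
  have hnorm : (monomialNorm ν n n : ℂ) ≠ 0 :=
    Complex.ofReal_ne_zero.2 (hν.monomialNorm_pos le_rfl).ne'
  exact zerosIn_eq_of_eqOn_mul hU (analyticOnNhd_weightedPoly n a)
    (h := fun z => z ^ n / monomialNorm ν n n) (fun z _ => by fun_prop)
    (fun z hz => div_ne_zero (pow_ne_zero n (hne hz)) hnorm)
    fun z hz => hν.weightedPoly_eq_mul_coeffSeries_const_div hR n a (hne hz)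

end Zeros

section Main

open FormalMultilinearSeries (ofScalars)

lemma mapsTo_div_disk {R : ℝ} (hR : 0 < R) :
    Set.MapsTo (fun z : ℂ => z / R) (disk R) (disk 1) := fun z hz => by
  rw [mem_disk, norm_div, Complex.norm_real, Real.norm_of_nonneg hR.le]
  exact (div_lt_one hR).2 hz

lemma mapsTo_const_div_exteriorDisk {R : ℝ} (hR : 0 < R) :
    Set.MapsTo (fun z : ℂ => (R : ℂ) / z) (exteriorDisk R) (disk 1) := fun z hz => by
  rw [mem_disk, norm_div, Complex.norm_real, Real.norm_of_nonneg hR.le]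
  exact (div_lt_one (hR.trans hz)).2 hz

lemma zero_notMem_exteriorDisk {R : ℝ} (hR : 0 ≤ R) : 0 ∉ exteriorDisk R := by
  simpa [mem_exteriorDisk] using hR

lemma analyticOnNhd_const_div {U : Set ℂ} (c : ℂ) (hU0 : 0 ∉ U) :
    AnalyticOnNhd ℂ (fun z : ℂ => c / z) U := fun z hz => by
  have : z ≠ 0 := ne_of_mem_of_not_mem hz hU0
  fun_prop (disch := assumption)

lemma map_zerosIn_coeffSeries_diskDilation {a : ℕ → ℂ} (ha : 1 ≤ (ofScalars ℂ a).radius) {R : ℝ}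
    (hR : 0 < R) : (zerosIn (disk 1) (coeffSeries a)).map (diskDilation hR)
      = zerosIn (disk R) fun z => coeffSeries a (z / R) :=
  map_zerosIn_dilation (diskDilation hR) (Complex.ofReal_ne_zero.2 hR.ne') (fun _ => rfl)
    ((analyticOnNhd_coeffSeries a).mono (disk_one_subset_eball_radius ha))

lemma map_zerosIn_coeffSeries_exteriorDilation {a : ℕ → ℂ} (ha : 1 ≤ (ofScalars ℂ a).radius)
    {R : ℝ} (hR : 0 < R) :
    (zerosIn (exteriorDisk 1) fun z => coeffSeries a (1 / z)).map (exteriorDilation hR)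
      = zerosIn (exteriorDisk R) fun z => coeffSeries a (R / z) := by
  have hmaps : Set.MapsTo (fun z : ℂ => 1 / z) (exteriorDisk 1) (disk 1) := by
    simpa using mapsTo_const_div_exteriorDisk one_pos
  have hanalytic : AnalyticOnNhd ℂ (fun z => coeffSeries a (1 / z)) (exteriorDisk 1) :=
    (analyticOnNhd_coeffSeries a).comp
      (analyticOnNhd_const_div 1 (zero_notMem_exteriorDisk zero_le_one))
      (hmaps.mono_right (disk_one_subset_eball_radius ha))
  simpa only [one_div_div] using map_zerosIn_dilation (exteriorDilation hR)
    (Complex.ofReal_ne_zero.2 hR.ne') (fun _ => rfl) hanalytic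

variable {Ω : Type*} [MeasurableSpace Ω] {μ : Measure Ω} [IsProbabilityMeasure μ] {a : ℕ → Ω → ℂ}
  {ν : Measure ℂ} [IsProbabilityMeasure ν] {R : ℝ}

theorem tendstoInDistribution_zerosIn_weightedPoly_disk (hexch : IsExchangeable μ a)
    (hne : ∀ᵐ ω ∂μ, ∃ k, a k ω ≠ 0)
    (hrad : ∀ᵐ ω ∂μ, 1 ≤ (ofScalars ℂ fun k => a k ω).radius) (hν : IsBackground ν) (hR : 0 < R)
    (hcomp : IsComponentOf (disk R) ν.supportᶜ) :
    TendstoInDistribution (fun n ω => zerosIn (disk R) (weightedPoly ν n fun k => a k ω)) atTop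
      (fun ω => (zerosIn (disk 1) (coeffSeries fun k => a k ω)).map (diskDilation hR))
      (fun _ => μ) μ := by
  have hs := measurable_logOutward R
  have hi := hν.integrable_logOutward R
  have h0 := hν.ae_logOutward_nonneg hR hcomp
  have hlim := tendsto_momentRatio hs hi h0 fun ε hε => hν.measure_logOutward_lt_pos hR hcomp hε
  have hderiv (z : ℂ) : deriv (fun z : ℂ => z / R) z ≠ 0 := by simp [hR.ne']
  refine (tendstoInDistribution_zerosIn_coeffSeries
    (c := fun n k => (momentRatio ν (logOutward R) n k : ℂ)) (fun _ => hexch 1)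
    (hne.mono fun ω hω => Function.ne_iff.2 hω) hrad
    (fun n => (Set.finite_Iic n).subset (support_ofReal_momentRatio_subset n))
    (fun n k => by simpa using abs_momentRatio_le_one hs hi h0 n k)
    (fun k => by exact_mod_cast (hlim k).ofReal) (isOpen_disk R) (fun z _ => by fun_prop)
    (fun z _ => hderiv z) (mapsTo_div_disk hR)).congr (fun n => ?_) ?_
  · exact .of_forall fun ω => (zerosIn_weightedPoly_eq_div hν hR (isOpen_disk R) n _).symm
  · exact hrad.mono fun ω hω => (map_zerosIn_coeffSeries_diskDilation hω hR).symm

theorem tendstoInDistribution_zerosIn_weightedPoly_exteriorDisk (hexch : IsExchangeable μ a)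
    (hne : ∀ᵐ ω ∂μ, ∃ k, a k ω ≠ 0)
    (hrad : ∀ᵐ ω ∂μ, 1 ≤ (ofScalars ℂ fun k => a k ω).radius) (hν : IsBackground ν) (hR : 0 < R)
    (hcomp : IsComponentOf (exteriorDisk R) ν.supportᶜ) :
    TendstoInDistribution
      (fun n ω => zerosIn (exteriorDisk R) (weightedPoly ν n fun k => a k ω)) atTop
      (fun ω => (zerosIn (exteriorDisk 1) fun z => coeffSeries (fun k => a k ω) (1 / z)).map
        (exteriorDilation hR)) (fun _ => μ) μ := by
  have hs := measurable_logInward R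
  have hi := hν.integrable_logInward R
  have h0 := hν.ae_logInward_nonneg hR hcomp
  have hlim := tendsto_momentRatio hs hi h0 fun ε hε => hν.measure_logInward_lt_pos hR hcomp hε
  have hU := isOpen_exteriorDisk R
  have hU0 : 0 ∉ exteriorDisk R := zero_notMem_exteriorDisk hR.le
  have hderiv (z : ℂ) (hz : z ∈ exteriorDisk R) : deriv (fun z : ℂ => R / z) z ≠ 0 := by
    simp [div_eq_mul_inv, hR.ne', ne_of_mem_of_not_mem hz hU0]
  refine (tendstoInDistribution_zerosIn_coeffSeries
    (c := fun n k => (momentRatio ν (logInward R) n k : ℂ)) (fun n => hexch (reverseUpTo n))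
    (hne.mono fun ω hω => Function.ne_iff.2 hω) hrad
    (fun n => (Set.finite_Iic n).subset (support_ofReal_momentRatio_subset n))
    (fun n k => by simpa using abs_momentRatio_le_one hs hi h0 n k)
    (fun k => by exact_mod_cast (hlim k).ofReal) hU (analyticOnNhd_const_div R hU0) hderiv
    (mapsTo_const_div_exteriorDisk hR)).congr (fun n => ?_) ?_
  · exact .of_forall fun ω =>
      (zerosIn_weightedPoly_eq_const_div hν hR hU hU0 n fun k => a k ω).symm
  · exact hrad.mono fun ω hω => (map_zerosIn_coeffSeries_exteriorDilation hω hR).symm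

end Main

theorem theorem3_general {Ω : Type*} [MeasurableSpace Ω] (μ : Measure Ω) [IsProbabilityMeasure μ]
    (a : ℕ → Ω → ℂ) (hexch : IsExchangeable μ a)
    (hlog : Integrable (fun ω => Real.log (1 + ‖a 0 ω‖)) μ) (hne : ∀ᵐ ω ∂μ, ∃ k, a k ω ≠ 0)
    (ν : Measure ℂ) [IsProbabilityMeasure ν] (hν : IsBackground ν)
    (R : ℝ) (hR : 0 < R) :
    (IsComponentOf (disk R) ν.supportᶜ →
      (∀ᵐ ω ∂μ, ∀ z ∈ disk 1, Summable fun k : ℕ => a k ω * z ^ k) ∧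
      TendstoInDistribution
        (fun (n : ℕ) (ω : Ω) => zerosIn (disk R) (weightedPoly ν n fun k => a k ω))
        atTop
        (fun ω : Ω => (zerosIn (disk 1) (coeffSeries fun k => a k ω)).map (diskDilation hR))
        (fun _ => μ) μ) ∧
    (IsComponentOf (exteriorDisk R) ν.supportᶜ →
      (∀ᵐ ω ∂μ, ∀ z ∈ exteriorDisk 1, Summable fun k : ℕ => a k ω * (1 / z) ^ k) ∧
      TendstoInDistribution
        (fun (n : ℕ) (ω : Ω) => zerosIn (exteriorDisk R) (weightedPoly ν n fun k => a k ω))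
        atTop
        (fun ω : Ω => (zerosIn (exteriorDisk 1) fun z => coeffSeries (fun k => a k ω) (1 / z)).map
          (exteriorDilation hR))
        (fun _ => μ) μ) := by
  have hrad := ae_one_le_radius_ofScalars hexch.identDistrib hlog
  have hsum : ∀ᵐ ω ∂μ, ∀ z ∈ disk 1, Summable fun k => a k ω * z ^ k :=
    hrad.mono fun ω hω z hz => summable_mul_pow (disk_one_subset_eball_radius hω hz)
  refine ⟨fun hcomp => ⟨hsum, ?_⟩, fun hcomp => ⟨hsum.mono fun ω hω z hz => hω _ ?_, ?_⟩⟩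
  · exact tendstoInDistribution_zerosIn_weightedPoly_disk hexch hne hrad hν hR hcomp
  · simpa using mapsTo_const_div_exteriorDisk one_pos hz
  · exact tendstoInDistribution_zerosIn_weightedPoly_exteriorDisk hexch hne hrad hν hR hcomp

theorem theorem3 {Ω : Type*} [MeasurableSpace Ω] (μ : Measure Ω) [IsProbabilityMeasure μ]
    (a : ℕ → Ω → ℂ) (ha : IsCoefficientSequence μ a)
    (ν : Measure ℂ) [IsProbabilityMeasure ν] (hν : IsBackground ν)
    (R : ℝ) (hR : 0 < R) :
    (IsComponentOf (disk R) ν.supportᶜ →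
      (∀ᵐ ω ∂μ, ∀ z ∈ disk 1, Summable fun k : ℕ => a k ω * z ^ k) ∧
      TendstoInDistribution
        (fun (n : ℕ) (ω : Ω) => zerosIn (disk R) (weightedPoly ν n fun k => a k ω))
        atTop
        (fun ω : Ω => (zerosIn (disk 1) (coeffSeries fun k => a k ω)).map (diskDilation hR))
        (fun _ => μ) μ) ∧
    (IsComponentOf (exteriorDisk R) ν.supportᶜ →
      (∀ᵐ ω ∂μ, ∀ z ∈ exteriorDisk 1, Summable fun k : ℕ => a k ω * (1 / z) ^ k) ∧
      TendstoInDistribution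
        (fun (n : ℕ) (ω : Ω) => zerosIn (exteriorDisk R) (weightedPoly ν n fun k => a k ω))
        atTop
        (fun ω : Ω => (zerosIn (exteriorDisk 1) fun z => coeffSeries (fun k => a k ω) (1 / z)).map
          (exteriorDilation hR))
        (fun _ => μ) μ) :=
  theorem3_general μ a ha.isExchangeable ha.integrable_log (ha.ae_ne_zero.mono fun _ h => ⟨0, h⟩)
    ν hν R hR
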